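/- A function $\nu$ that assigns a real number to every Borel set of $\mathbb{R}$ bounded away from $0$ is called a quasi-Lévy type measure if, for every $r>0$, its restriction to the Borel sets $B$ with $B\cap(-r,r)=\emptyset$ is a finite signed measure, and $\int_{\mathbb{R}}(1\wedge x^2)\,|\nu|(dx)<\infty$, where $|\nu|=\nu^++\nu^-$ is the total variation (with $\nu^{\pm}(\{0\})=0$). A probability measure $\mu$ on $\mathbb{R}$ is quasi-infinitely divisible (QID) if there are $a,\gamma\in\mathbb{R}$ and a quasi-Lévy type measure $\nu$ such that for all $z\in\mathbb{R}$ $$\hat\mu(z)=\int_{\mathbb R} e^{ixz}\,\mu(dx)=\exp\Big(-\tfrac12 az^2+i\gamma z+\int_{\mathbb{R}}\big(e^{ixz}-1-ixz\mathbf 1_{[-1,1]}(x)\big)\,\nu(dx)\Big).$$ **(a)** Let $L=(L_t)_{t\ge 0}$ be a real-valued Lévy process such that the law $\mathcal{L}(L_t)$ is absolutely continuous with respect to Lebesgue measure for every $t>0$. Let $\varrho$ be a probability measure on $\mathbb{R}$ and $t_1>0$ such that $\varrho((-\infty,t_1))=0$ and $\varrho(\{t_1\})>0$. Then $\mu(B):=\int_{[t_1,\infty)}\mathcal{L}(L_t)(B)\,\varrho(dt)$,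 for $B\subseteq\mathbb{R}$ Borel, is a well-defined probability measure, and $\mu$ is QID if and only if $\hat\mu(z)\ne 0$ for all $z\in\mathbb{R}$. In particular, if $n\ge1$, $0<t_1<t_2<\dots<t_n$, $p_1,\dots,p_n>0$ and $\sum_{i=1}^n p_i=1$, then $\mu=\sum_{i=1}^n p_i\,\mathcal{L}(L_{t_i})$ is QID if and only if $\hat\mu(z)\neq 0$ for all $z\in\mathbb{R}$. **(b)** If, in the situation of (a), $\mathcal{L}(L_1)$ is symmetric, then $\hat\mu(z)\neq0$ for all $z\in\mathbb{R}$, and hence $\mu$ is QID (both for general $\varrho$ and for finite mixtures). **(c)** For $\varrho$ and $t_1$ as in (a), the variance mixture $\mu(B)=\int_{[t_1,\infty)}N(0,t)(B)\,\varrho(dt)$ of centred normal distributions is a well-defined probability measure and is QID. In particular, $\sum_{i=1}^n p_iN(0,a_i)$ is QID whenever $n\ge1$, $a_1,\dots,a_n>0$, $p_1,\dots,p_n>0$ and $\sum_{i=1}^n p_i=1$. -/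

import Mathlib

open MeasureTheory ProbabilityTheory Filter Topology Set
open scoped NNReal ENNReal

noncomputable section

namespace QuasiID

/-! ### Quasi-Lévy type measures -/

/-- `BddAwayZero r B`: `B` is a Borel set with `B ∩ (-r, r) = ∅`. -/
def BddAwayZero (r : ℝ) (B : Set ℝ) : Prop :=
  MeasurableSet B ∧ Disjoint B (Ioo (-r) r)

/-- A real function on the Borel sets bounded away from zero whose restriction to the Borel sets
disjoint from `(-r, r)` is a finite signed measure, for every `r > 0`. (The values of `toFun` on
other sets are irrelevant and never used.) -/
structure LocalSignedMeasure where
  toFun : Set ℝ → ℝ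
  exists_signedMeasure : ∀ r : ℝ, 0 < r →
    ∃ σ : SignedMeasure ℝ, ∀ B : Set ℝ, BddAwayZero r B → σ B = toFun B

namespace LocalSignedMeasure

variable (ν : LocalSignedMeasure)

/-- The restriction of `ν` to the Borel sets disjoint from `(-r, r)`, `r > 0`, regarded as a signed
measure on `ℝ` that lives on the complement of `(-r, r)`. -/
def restr (r : ℝ) (hr : 0 < r) : SignedMeasure ℝ :=
  (ν.exists_signedMeasure r hr).choose.restrict (Ioo (-r) r)ᶜ

theorem restr_apply (r : ℝ) (hr : 0 < r) {B : Set ℝ} (hB : MeasurableSet B) :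
    ν.restr r hr B = ν.toFun (B \ Ioo (-r) r) := by
  rw [restr, VectorMeasure.restrict_apply _ measurableSet_Ioo.compl hB]
  exact (ν.exists_signedMeasure r hr).choose_spec _
    ⟨hB.inter measurableSet_Ioo.compl, disjoint_sdiff_left⟩

/-- The Borel sets `{|x| ≥ 1}` (for `n = 0`) and `{1/(n+1) ≤ |x| < 1/n}` (for `n ≥ 1`), a partition
of `ℝ \ {0}`. -/
def annulus (n : ℕ) : Set ℝ :=
  {x | 1 / ((n : ℝ) + 1) ≤ |x| ∧ (n = 0 ∨ |x| < 1 / (n : ℝ))}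

/-- The positive part `ν⁺` of `ν`: the measure on `ℝ` without mass at `0` that on the Borel sets
disjoint from `(-r, r)` is the positive part of the Jordan decomposition of `ν.restr r`
(see `posPart_zero` and `posPart_apply`). -/
def posPart : Measure ℝ :=
  Measure.sum fun n : ℕ =>
    (ν.restr (1 / ((n : ℝ) + 1)) (by positivity)).toJordanDecomposition.posPart.restrict (annulus n)

/-- The negative part `ν⁻` of `ν` (see `negPart_zero` and `negPart_apply`). -/
def negPart : Measure ℝ :=
  Measure.sum fun n : ℕ =>
    (ν.restr (1 / ((n : ℝ) + 1)) (by positivity)).toJordanDecomposition.negPart.restrict (annulus n)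

/-- The total variation `|ν| = ν⁺ + ν⁻`. -/
def totalVariation : Measure ℝ := ν.posPart + ν.negPart

theorem measurableSet_annulus (n : ℕ) : MeasurableSet (annulus n) := by
  apply MeasurableSet.inter
  · exact measurableSet_le measurable_const continuous_abs.measurable
  · apply MeasurableSet.union
    · exact MeasurableSet.const _
    · exact measurableSet_lt continuous_abs.measurable measurable_const

theorem exists_mem_annulus {x : ℝ} (hx : x ≠ 0) : ∃ n, x ∈ annulus n := by
  classical
  have h : ∃ n : ℕ, 1 / ((n : ℝ) + 1) ≤ |x| := by
    obtain ⟨n, hn⟩ := exists_nat_one_div_lt (abs_pos.2 hx)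
    exact ⟨n, hn.le⟩
  refine ⟨Nat.find h, Nat.find_spec h, ?_⟩
  rcases Nat.eq_zero_or_pos (Nat.find h) with h0 | h0
  · exact Or.inl h0
  · right
    have := Nat.find_min h (m := Nat.find h - 1) (by omega)
    rw [not_le] at this
    have e : ((Nat.find h - 1 : ℕ) : ℝ) + 1 = (Nat.find h : ℝ) := by
      have : Nat.find h - 1 + 1 = Nat.find h := by omega
      exact_mod_cast this
    rwa [e] at this

theorem pairwise_disjoint_annulus : Pairwise (Function.onFun Disjoint annulus) := by
  have key : ∀ m n : ℕ, m < n → Disjoint (annulus m) (annulus n) := by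
    intro m n hmn
    rw [Set.disjoint_left]
    rintro x ⟨h1, -⟩ ⟨-, h2⟩
    rcases h2 with h2 | h2
    · omega
    · have h3 : 1 / (n : ℝ) ≤ 1 / ((m : ℝ) + 1) := by
        apply one_div_le_one_div_of_le (by positivity)
        exact_mod_cast hmn
      linarith
  intro m n hmn
  rcases lt_or_gt_of_ne hmn with h | h
  · exact key m n h
  · exact (key n m h).symm

theorem jordan_restrict {σ τ : SignedMeasure ℝ} {S : Set ℝ} (hS : MeasurableSet S)
    (h : τ = σ.restrict S) :
    τ.toJordanDecomposition.posPart = σ.toJordanDecomposition.posPart.restrict S ∧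
      τ.toJordanDecomposition.negPart = σ.toJordanDecomposition.negPart.restrict S := by
  have hs : σ.toJordanDecomposition.posPart.restrict S ⟂ₘ
      σ.toJordanDecomposition.negPart.restrict S :=
    σ.toJordanDecomposition.mutuallySingular.mono_ac
      Measure.restrict_le_self.absolutelyContinuous Measure.restrict_le_self.absolutelyContinuous
  have : τ.toJordanDecomposition
      = ⟨σ.toJordanDecomposition.posPart.restrict S,
          σ.toJordanDecomposition.negPart.restrict S, hs⟩ := by
    apply SignedMeasure.toJordanDecomposition_eq
    ext B hB
    rw [h, VectorMeasure.restrict_apply _ hS hB,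
      SignedMeasure.apply_eq_posPart_real_sub_negPart_real σ (hB.inter hS),
      JordanDecomposition.toSignedMeasure, Measure.toSignedMeasure_sub_apply hB,
      measureReal_restrict_apply hB, measureReal_restrict_apply hB]
  rw [this]
  exact ⟨rfl, rfl⟩

theorem restr_eq_restrict {s r : ℝ} (hs : 0 < s) (hsr : s ≤ r) :
    ν.restr r (hs.trans_le hsr) = (ν.restr s hs).restrict (Ioo (-r) r)ᶜ := by
  ext B hB
  rw [VectorMeasure.restrict_apply _ measurableSet_Ioo.compl hB, restr_apply _ _ _ hB,
    restr_apply _ _ _ (hB.inter measurableSet_Ioo.compl)]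
  congr 1
  ext x
  simp only [Set.mem_sdiff, mem_inter_iff, mem_compl_iff, mem_Ioo]
  constructor
  · rintro ⟨h1, h2⟩
    exact ⟨⟨h1, h2⟩, fun h => h2 ⟨by linarith, by linarith⟩⟩
  · rintro ⟨h1, -⟩
    exact h1

theorem jordan_restr_agree {s r : ℝ} (hs : 0 < s) (hr : 0 < r) {B : Set ℝ}
    (hBs : BddAwayZero s B) (hBr : BddAwayZero r B) :
    (ν.restr s hs).toJordanDecomposition.posPart B
        = (ν.restr r hr).toJordanDecomposition.posPart B ∧
      (ν.restr s hs).toJordanDecomposition.negPart B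
        = (ν.restr r hr).toJordanDecomposition.negPart B := by
  have key : ∀ {s r : ℝ} (hs : 0 < s) (hsr : s ≤ r) (_ : BddAwayZero r B),
      (ν.restr s hs).toJordanDecomposition.posPart B
          = (ν.restr r (hs.trans_le hsr)).toJordanDecomposition.posPart B ∧
        (ν.restr s hs).toJordanDecomposition.negPart B
          = (ν.restr r (hs.trans_le hsr)).toJordanDecomposition.negPart B := by
    intro s r hs hsr hB
    have hsub : B ∩ (Ioo (-r) r)ᶜ = B :=
      inter_eq_left.2 (disjoint_left.1 hB.2)
    have hj := jordan_restrict measurableSet_Ioo.compl (ν.restr_eq_restrict hs hsr)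
    rw [hj.1, hj.2, Measure.restrict_apply hB.1, Measure.restrict_apply hB.1, hsub]
    exact ⟨rfl, rfl⟩
  rcases le_total s r with h | h
  · exact key hs h hBr
  · have := key hr h hBs
    exact ⟨this.1.symm, this.2.symm⟩

theorem zero_notMem_annulus (n : ℕ) : (0 : ℝ) ∉ annulus n := by
  rintro ⟨h, -⟩
  rw [abs_zero] at h
  have : 0 < 1 / ((n : ℝ) + 1) := by positivity
  linarith

theorem posPart_zero : ν.posPart {0} = 0 := by
  rw [posPart, Measure.sum_apply _ (measurableSet_singleton 0)]
  simp [Measure.restrict_apply, zero_notMem_annulus]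

theorem negPart_zero : ν.negPart {0} = 0 := by
  rw [negPart, Measure.sum_apply _ (measurableSet_singleton 0)]
  simp [Measure.restrict_apply, zero_notMem_annulus]

theorem bddAwayZero_annulus (n : ℕ) {B : Set ℝ} (hB : MeasurableSet B) :
    BddAwayZero (1 / ((n : ℝ) + 1)) (B ∩ annulus n) := by
  refine ⟨hB.inter (measurableSet_annulus n), ?_⟩
  rw [Set.disjoint_left]
  rintro x ⟨-, h, -⟩ hx
  exact absurd (abs_lt.2 hx) (not_lt.2 h)

theorem sum_inter_annulus (μ : Measure ℝ) {r : ℝ} (hr : 0 < r) {B : Set ℝ}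
    (hB : BddAwayZero r B) : ∑' n : ℕ, μ (B ∩ annulus n) = μ B := by
  rw [← measure_iUnion]
  · congr 1
    rw [← inter_iUnion, inter_eq_left]
    intro x hx
    have hx0 : x ≠ 0 := by
      rintro rfl
      exact (disjoint_left.1 hB.2) hx ⟨by linarith, hr⟩
    exact mem_iUnion.2 (exists_mem_annulus hx0)
  · intro m n hmn
    exact (pairwise_disjoint_annulus hmn).mono inter_subset_right inter_subset_right
  · exact fun n => hB.1.inter (measurableSet_annulus n)

theorem posPart_apply {r : ℝ} (hr : 0 < r) {B : Set ℝ} (hB : BddAwayZero r B) :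
    ν.posPart B = (ν.restr r hr).toJordanDecomposition.posPart B := by
  rw [posPart, Measure.sum_apply _ hB.1, ← sum_inter_annulus _ hr hB]
  refine tsum_congr fun n => ?_
  rw [Measure.restrict_apply hB.1]
  exact (ν.jordan_restr_agree _ hr (bddAwayZero_annulus n hB.1)
    ⟨hB.1.inter (measurableSet_annulus n), hB.2.mono_left inter_subset_left⟩).1

theorem negPart_apply {r : ℝ} (hr : 0 < r) {B : Set ℝ} (hB : BddAwayZero r B) :
    ν.negPart B = (ν.restr r hr).toJordanDecomposition.negPart B := by
  rw [negPart, Measure.sum_apply _ hB.1, ← sum_inter_annulus _ hr hB]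
  refine tsum_congr fun n => ?_
  rw [Measure.restrict_apply hB.1]
  exact (ν.jordan_restr_agree _ hr (bddAwayZero_annulus n hB.1)
    ⟨hB.1.inter (measurableSet_annulus n), hB.2.mono_left inter_subset_left⟩).2

/-- `ν` is a quasi-Lévy type measure: `∫ (1 ∧ x²) |ν|(dx) < ∞`. -/
def IsQuasiLevyType : Prop :=
  ∫⁻ x, ENNReal.ofReal (min 1 (x ^ 2)) ∂ν.totalVariation < ∞

/-- `∫ f dν = ∫ f dν⁺ - ∫ f dν⁻`; it is only used for quasi-Lévy type measures and continuous or
piecewise continuous `f` with `|f(x)| ≤ C (1 ∧ x²)`, where both integrals converge absolutely. -/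
def integral (f : ℝ → ℂ) : ℂ := ∫ x, f x ∂ν.posPart - ∫ x, f x ∂ν.negPart

end LocalSignedMeasure

/-- A distribution `μ` on `ℝ` is quasi-infinitely divisible if its characteristic function has a
Lévy-Khintchine representation with `a, γ ∈ ℝ` and a quasi-Lévy type measure `ν`. -/
def IsQuasiInfinitelyDivisible (μ : Measure ℝ) : Prop :=
  IsProbabilityMeasure μ ∧
    ∃ (a γ : ℝ) (ν : LocalSignedMeasure), ν.IsQuasiLevyType ∧ ∀ z : ℝ,
      charFun μ z = Complex.exp (-(1 / 2) * a * z ^ 2 + Complex.I * γ * z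
        + ν.integral fun x => Complex.exp (Complex.I * x * z) - 1
            - Complex.I * x * z * (Icc (-1 : ℝ) 1).indicator (fun _ => (1 : ℂ)) x)

/-! ### Lévy processes and mixtures -/

/-- A real-valued Lévy process `(L_t)_{t ≥ 0}` on a probability space: it starts at `0` almost
surely, has independent and stationary increments, is stochastically continuous, and almost all of
its paths are right-continuous with left limits. -/
structure IsLevyProcess {Ω : Type*} [MeasurableSpace Ω] (L : ℝ≥0 → Ω → ℝ) (P : Measure Ω) :
    Prop where
  measurable : ∀ t, Measurable (L t)
  zero : ∀ᵐ ω ∂P, L 0 ω = 0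
  indep : HasIndepIncrements L P
  stationary : ∀ s t : ℝ≥0, P.map (fun ω => L (s + t) ω - L s ω) = P.map (fun ω => L t ω - L 0 ω)
  stochContinuous : ∀ t, TendstoInMeasure P L (𝓝 t) (L t)
  cadlag : ∀ᵐ ω ∂P, ∀ t : ℝ≥0, ContinuousWithinAt (fun s => L s ω) (Ici t) t ∧
    ∃ l : ℝ, Tendsto (fun s => L s ω) (𝓝[<] t) (𝓝 l)

/-- The mixture `∫_{[t₁,∞)} κ_t ϱ(dt)` of the distributions `κ_t`, `t ≥ 0`, where `t₁ ≥ 0`. -/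
def mixture (κ : ℝ≥0 → Measure ℝ) (ρ : Measure ℝ) (t₁ : ℝ) : Measure ℝ :=
  (ρ.restrict (Ici t₁)).bind fun t => κ t.toNNReal

/-- `m` is the mixture `∫_{[t₁,∞)} κ_t ϱ(dt)` setwise: it is a probability measure, and
`m(B) = ∫_{[t₁,∞)} κ_t(B) ϱ(dt)` for every Borel set `B`, with a measurable integrand. -/
def IsMixture (m : Measure ℝ) (κ : ℝ≥0 → Measure ℝ) (ρ : Measure ℝ) (t₁ : ℝ) : Prop :=
  IsProbabilityMeasure m ∧ ∀ B : Set ℝ, MeasurableSet B →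
    Measurable (fun t : ℝ => κ t.toNNReal B) ∧ m B = ∫⁻ t in Ici t₁, κ t.toNNReal B ∂ρ

/-- A distribution on `ℝ` is symmetric if it is invariant under `x ↦ -x`. -/
def IsSymmetric (μ : Measure ℝ) : Prop := μ.map (fun x => -x) = μ

end QuasiID

end

/-!
The marginals of a Lévy process and the centred normal distributions `N(0, t)` form weakly
continuous convolution semigroups `κ` (`IsConvolutionSemigroup`). For such a semigroup,
`charFun (κ t) z = exp (t ψ(z))` with a continuous exponent `ψ`, and `ψ` has a Lévy–Khintchine
representation (`IsConvolutionSemigroup.exists_exponent` and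
`IsConvolutionSemigroup.exists_levyKhintchine`).

A mixture `μ` of the `κ t` over a distribution `ρ` on `[t₁, ∞)` has `κ t₁` as a convolution factor:
`charFun μ = charFun (κ t₁) * (p + charFun η)`, where `p = ρ {t₁} > 0` and `η` is a mixture of the
`κ (t - t₁)`, `t > t₁`, hence absolutely continuous. The first factor is infinitely divisible, and
the point is that the second factor, the characteristic function of `p δ₀ + η`, is the exponential
of a Lévy–Khintchine exponent as soon as it has no zeros (`exists_add_charFun_eq_exp`). Conversely
an exponential has no zeros.

The result on `p δ₀ + η` is a Wiener–Lévy theorem (`exists_add_fourier_eq_exp`). Let `g` be the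
density of `η`, so that `p + 𝓕 g` is the function at hand up to scaling. Up to the Fourier
transform of a function small in `L¹`, `𝓕 g` is a Schwartz function `s`, and `p + s` has no zeros
either. The quotient
`(p + 𝓕 g) / (p + s)` has a logarithm in the algebra of Fourier transforms of integrable functions,
given by the power series of the logarithm: the series converges because the norms of
`(p + s)⁻ⁿ - p⁻ⁿ` in this algebra, estimated through two derivatives, grow at the geometric rate of
the supremum norms (`exists_hasFourierNormLE_inv_pow_sub`). The smooth function `p + s` has the
logarithm `∫ s' / (p + s)`, and `s' / (p + s)` is the Fourier transform of an integrable function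
`ψ`. Under the integral sign this becomes a signed measure whose density is a multiple of
`ψ(x) / x`, which integrates `1 ∧ |x|`; its singularity at `0` accounts for the possibly different
limits of the logarithm at `±∞`, so winding numbers need not be discussed. Finally, the density may
be taken real because the characteristic function is Hermitian (`eq_exp_integral_re`).

If `κ 1` is symmetric, then `exp ψ` is real, so `ψ` is real by continuity, and `charFun μ`, a
mixture of the positive functions `exp (t ψ)`, is positive.

A signed measure is written throughout as the difference of two positive measures of Lévy type;
`IsQuasiInfinitelyDivisible.of_charFun_eq` translates this into Jordan decompositions.
-/

noncomputable section

namespace QuasiID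

/-! ### Differences of two Lévy-type measures -/

/-- `α` is a measure of Lévy type: no mass at `0`, and `∫ (1 ∧ x²) dα < ∞`. -/
structure IsLevyType (α : Measure ℝ) : Prop where
  zero : α {0} = 0
  lintegral_lt_top : ∫⁻ x, ENNReal.ofReal (min 1 (x ^ 2)) ∂α < ∞

theorem measurable_min_one_sq : Measurable fun x : ℝ => min 1 (x ^ 2) := by fun_prop

theorem IsLevyType.integrable {α : Measure ℝ} (hα : IsLevyType α) :
    Integrable (fun x : ℝ => min 1 (x ^ 2)) α := by
  refine ⟨measurable_min_one_sq.aestronglyMeasurable, ?_⟩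
  rw [hasFiniteIntegral_iff_ofReal (Eventually.of_forall fun x => by positivity)]
  exact hα.lintegral_lt_top

theorem IsLevyType.isFiniteMeasure_restrict {α : Measure ℝ} (hα : IsLevyType α) {r : ℝ}
    (hr : 0 < r) : IsFiniteMeasure (α.restrict (Ioo (-r) r)ᶜ) := by
  constructor
  rw [Measure.restrict_apply_univ]
  have h1 : 0 < min 1 (r ^ 2) := by positivity
  refine lt_of_le_of_lt (measure_mono ?_) (hα.integrable.measure_ge_lt_top h1)
  intro x hx
  have hx' : r ≤ |x| := by
    by_contra h
    exact hx (abs_lt.1 (not_le.1 h))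
  have : r ^ 2 ≤ x ^ 2 := by rw [← sq_abs x]; gcongr
  exact min_le_min_left 1 this

theorem IsLevyType.sum_restrict_annulus {α : Measure ℝ} (hα : IsLevyType α) :
    Measure.sum (fun n => α.restrict (LocalSignedMeasure.annulus n)) = α := by
  rw [← Measure.restrict_iUnion LocalSignedMeasure.pairwise_disjoint_annulus
    LocalSignedMeasure.measurableSet_annulus]
  apply Measure.restrict_eq_self_of_ae_mem
  have : ∀ᵐ x ∂α, x ≠ 0 := by
    rw [ae_iff]; simpa using hα.zero
  filter_upwards [this] with x hx
  exact mem_iUnion.2 (LocalSignedMeasure.exists_mem_annulus hx)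

theorem IsLevyType.add {α β : Measure ℝ} (hα : IsLevyType α) (hβ : IsLevyType β) :
    IsLevyType (α + β) := by
  constructor
  · simp [hα.zero, hβ.zero]
  · rw [lintegral_add_measure]
    exact ENNReal.add_lt_top.2 ⟨hα.lintegral_lt_top, hβ.lintegral_lt_top⟩

theorem IsLevyType.smul {α : Measure ℝ} (hα : IsLevyType α) (c : ℝ≥0) : IsLevyType (c • α) := by
  constructor
  · simp [hα.zero]
  · rw [lintegral_smul_measure]
    exact ENNReal.mul_lt_top ENNReal.coe_lt_top hα.lintegral_lt_top

namespace LocalSignedMeasure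

/-- The difference `α - β` of two Lévy-type measures. -/
def ofSub (α β : Measure ℝ) (hα : IsLevyType α) (hβ : IsLevyType β) : LocalSignedMeasure where
  toFun B := α.real B - β.real B
  exists_signedMeasure r hr := by
    have := hα.isFiniteMeasure_restrict hr
    have := hβ.isFiniteMeasure_restrict hr
    refine ⟨(α.restrict (Ioo (-r) r)ᶜ).toSignedMeasure - (β.restrict (Ioo (-r) r)ᶜ).toSignedMeasure,
      fun B hB => ?_⟩
    have hs : B ∩ (Ioo (-r) r)ᶜ = B := inter_eq_left.2 (disjoint_left.1 hB.2)
    rw [Measure.toSignedMeasure_sub_apply hB.1, measureReal_restrict_apply hB.1,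
      measureReal_restrict_apply hB.1, hs]

variable {α β : Measure ℝ} (hα : IsLevyType α) (hβ : IsLevyType β)

theorem jordan_restr_ofSub {r : ℝ} (hr : 0 < r) :
    ((ofSub α β hα hβ).restr r hr).toJordanDecomposition.posPart
        = α.restrict (Ioo (-r) r)ᶜ - β.restrict (Ioo (-r) r)ᶜ ∧
      ((ofSub α β hα hβ).restr r hr).toJordanDecomposition.negPart
        = β.restrict (Ioo (-r) r)ᶜ - α.restrict (Ioo (-r) r)ᶜ := by
  have := hα.isFiniteMeasure_restrict hr
  have := hβ.isFiniteMeasure_restrict hr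
  have h : (ofSub α β hα hβ).restr r hr
      = (α.restrict (Ioo (-r) r)ᶜ).toSignedMeasure
        - (β.restrict (Ioo (-r) r)ᶜ).toSignedMeasure := by
    ext B hB
    rw [restr_apply _ _ _ hB, Measure.toSignedMeasure_sub_apply hB, measureReal_restrict_apply hB,
      measureReal_restrict_apply hB]
    rfl
  rw [h, Measure.toJordanDecomposition_toSignedMeasure_sub]
  exact ⟨rfl, rfl⟩

theorem restrict_annulus_restrict (n : ℕ) (α : Measure ℝ) :
    (α.restrict (Ioo (-(1 / ((n : ℝ) + 1))) (1 / ((n : ℝ) + 1)))ᶜ).restrict (annulus n)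
      = α.restrict (annulus n) := by
  rw [Measure.restrict_restrict (measurableSet_annulus n)]
  congr 1
  refine inter_eq_left.2 fun x hx h => ?_
  exact absurd (abs_lt.2 h) (not_lt.2 hx.1)

theorem posPart_ofSub_le : (ofSub α β hα hβ).posPart ≤ α := by
  conv_rhs => rw [← hα.sum_restrict_annulus]
  refine Measure.le_iff.2 fun s hs => ?_
  rw [posPart, Measure.sum_apply _ hs, Measure.sum_apply _ hs]
  refine ENNReal.tsum_le_tsum fun n => ?_
  rw [(jordan_restr_ofSub hα hβ _).1, ← restrict_annulus_restrict n α]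
  exact Measure.restrict_mono_measure Measure.sub_le _ s

theorem negPart_ofSub_le : (ofSub α β hα hβ).negPart ≤ β := by
  conv_rhs => rw [← hβ.sum_restrict_annulus]
  refine Measure.le_iff.2 fun s hs => ?_
  rw [negPart, Measure.sum_apply _ hs, Measure.sum_apply _ hs]
  refine ENNReal.tsum_le_tsum fun n => ?_
  rw [(jordan_restr_ofSub hα hβ _).2, ← restrict_annulus_restrict n β]
  exact Measure.restrict_mono_measure Measure.sub_le _ s

theorem sub_add_eq_sub_add (α β : Measure ℝ) [IsFiniteMeasure α] [IsFiniteMeasure β] :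
    (α - β) + β = (β - α) + α := by
  have h := Measure.sub_toSignedMeasure_eq_toSignedMeasure_sub (μ := α) (ν := β)
  ext s hs
  have h2 := congrArg (fun σ : SignedMeasure ℝ => σ s) h
  simp only [Measure.toSignedMeasure_sub_apply hs] at h2
  have h3 : ((α - β) + β).real s = ((β - α) + α).real s := by
    rw [measureReal_add_apply, measureReal_add_apply]
    linarith
  exact (measureReal_eq_measureReal_iff).1 h3

/-- The Jordan parts of `α - β` may be smaller than `α` and `β`, but by the same amount. -/
theorem posPart_add_eq_negPart_add :
    (ofSub α β hα hβ).posPart + β = (ofSub α β hα hβ).negPart + α := by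
  suffices h : (ofSub α β hα hβ).posPart + Measure.sum (fun n => β.restrict (annulus n))
      = (ofSub α β hα hβ).negPart + Measure.sum (fun n => α.restrict (annulus n)) by
    rwa [hα.sum_restrict_annulus, hβ.sum_restrict_annulus] at h
  rw [posPart, negPart, Measure.sum_add_sum, Measure.sum_add_sum]
  congr 1
  funext n
  have hn : 0 < 1 / ((n : ℝ) + 1) := by positivity
  have := hα.isFiniteMeasure_restrict hn
  have := hβ.isFiniteMeasure_restrict hn
  rw [(jordan_restr_ofSub hα hβ _).1, (jordan_restr_ofSub hα hβ _).2,
    ← restrict_annulus_restrict n α, ← restrict_annulus_restrict n β,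
    ← Measure.restrict_add, ← Measure.restrict_add, sub_add_eq_sub_add]

theorem isQuasiLevyType_ofSub : (ofSub α β hα hβ).IsQuasiLevyType := by
  refine lt_of_le_of_lt (lintegral_mono' ?_ le_rfl) (hα.add hβ).lintegral_lt_top
  exact add_le_add (posPart_ofSub_le hα hβ) (negPart_ofSub_le hα hβ)

theorem integral_ofSub {f : ℝ → ℂ} (hfα : Integrable f α) (hfβ : Integrable f β) :
    (ofSub α β hα hβ).integral f = ∫ x, f x ∂α - ∫ x, f x ∂β := by
  have h := congrArg (fun m : Measure ℝ => ∫ x, f x ∂m) (posPart_add_eq_negPart_add hα hβ)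
  rw [integral_add_measure (hfα.mono_measure (posPart_ofSub_le hα hβ)) hfβ,
    integral_add_measure (hfβ.mono_measure (negPart_ofSub_le hα hβ)) hfα] at h
  rw [LocalSignedMeasure.integral, sub_eq_sub_iff_add_eq_add, h, add_comm]

end LocalSignedMeasure

/-! ### The Lévy–Khintchine integrand -/

/-- The Lévy–Khintchine integrand `e^{ixz} - 1 - ixz 1_{[-1,1]}(x)`. -/
def lkKernel (z x : ℝ) : ℂ :=
  Complex.exp (Complex.I * x * z) - 1
    - Complex.I * x * z * (Icc (-1 : ℝ) 1).indicator (fun _ => (1 : ℂ)) x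

theorem measurable_lkKernel (z : ℝ) : Measurable (lkKernel z) := by
  unfold lkKernel
  have : Measurable ((Icc (-1 : ℝ) 1).indicator (fun _ => (1 : ℂ))) :=
    measurable_const.indicator measurableSet_Icc
  fun_prop

theorem norm_exp_I_mul_sub_one_le_two (x z : ℝ) :
    ‖Complex.exp (Complex.I * x * z) - 1‖ ≤ 2 := by
  refine (norm_sub_le _ _).trans ?_
  rw [mul_assoc, mul_comm, ← Complex.ofReal_mul, Complex.norm_exp_ofReal_mul_I]
  norm_num

theorem norm_exp_I_mul_sub_one_le (x z : ℝ) :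
    ‖Complex.exp (Complex.I * x * z) - 1‖ ≤ |x| * |z| := by
  have := Real.norm_exp_I_mul_ofReal_sub_one_le (x := x * z)
  rw [Complex.ofReal_mul, ← mul_assoc] at this
  simpa using this

theorem norm_exp_I_mul_sub_one_sub_le (x z : ℝ) :
    ‖Complex.exp (Complex.I * x * z) - 1 - Complex.I * x * z‖ ≤ 3 * (x ^ 2 * z ^ 2) := by
  by_cases h : |x * z| ≤ 1
  · have h1 : ‖Complex.I * x * z‖ = |x * z| := by simp [abs_mul]
    have := Complex.norm_exp_sub_one_sub_id_le (x := Complex.I * x * z) (by rw [h1]; exact h)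
    refine this.trans ?_
    rw [h1, sq_abs, mul_pow]
    nlinarith [mul_nonneg (sq_nonneg x) (sq_nonneg z)]
  · have h1 : ‖Complex.I * x * z‖ = |x * z| := by simp [abs_mul]
    have h2 := norm_sub_le (Complex.exp (Complex.I * x * z) - 1) (Complex.I * x * z)
    have h3 := norm_exp_I_mul_sub_one_le_two x z
    rw [← mul_pow, ← sq_abs (x * z)]
    nlinarith

theorem norm_lkKernel_le (z x : ℝ) : ‖lkKernel z x‖ ≤ (2 + 3 * z ^ 2) * min 1 (x ^ 2) := by
  unfold lkKernel
  by_cases hx : x ∈ Icc (-1 : ℝ) 1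
  · have h1 : x ^ 2 ≤ 1 := by nlinarith [hx.1, hx.2]
    rw [indicator_of_mem hx, mul_one, min_eq_right h1]
    refine (norm_exp_I_mul_sub_one_sub_le x z).trans ?_
    nlinarith [sq_nonneg x]
  · have h1 : 1 ≤ x ^ 2 := by
      rw [mem_Icc, ← abs_le, not_le] at hx
      rw [← sq_abs]; nlinarith
    rw [indicator_of_notMem hx, mul_zero, sub_zero, min_eq_left h1]
    refine (norm_exp_I_mul_sub_one_le_two x z).trans ?_
    nlinarith [sq_nonneg z]

theorem IsLevyType.integrable_lkKernel {α : Measure ℝ} (hα : IsLevyType α) (z : ℝ) :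
    Integrable (lkKernel z) α :=
  (hα.integrable.const_mul (2 + 3 * z ^ 2)).mono' (measurable_lkKernel z).aestronglyMeasurable
    (Eventually.of_forall fun x => norm_lkKernel_le z x)

theorem IsQuasiInfinitelyDivisible.of_charFun_eq {μ α β : Measure ℝ} [IsProbabilityMeasure μ]
    (hα : IsLevyType α) (hβ : IsLevyType β) (a γ : ℝ)
    (h : ∀ z : ℝ, charFun μ z = Complex.exp (-(1 / 2) * a * z ^ 2 + Complex.I * γ * z
      + (∫ x, lkKernel z x ∂α - ∫ x, lkKernel z x ∂β))) :
    IsQuasiInfinitelyDivisible μ := by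
  refine ⟨inferInstance, a, γ, LocalSignedMeasure.ofSub α β hα hβ,
    LocalSignedMeasure.isQuasiLevyType_ofSub hα hβ, fun z => ?_⟩
  rw [h z, ← LocalSignedMeasure.integral_ofSub hα hβ (hα.integrable_lkKernel z)
    (hβ.integrable_lkKernel z)]
  rfl

theorem IsQuasiInfinitelyDivisible.charFun_ne_zero {μ : Measure ℝ}
    (h : IsQuasiInfinitelyDivisible μ) (z : ℝ) : charFun μ z ≠ 0 := by
  obtain ⟨-, a, γ, ν, -, hz⟩ := h
  rw [hz z]
  exact Complex.exp_ne_zero _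

section

open scoped FourierTransform SchwartzMap Convolution

/-! ### The algebra of Fourier transforms of integrable functions -/

/-- `u` is the Fourier transform of an integrable function of `L¹`-norm at most `M`. -/
def HasFourierNormLE (u : ℝ → ℂ) (M : ℝ) : Prop :=
  ∃ h : ℝ → ℂ, Integrable h ∧ 𝓕 h = u ∧ ∫ x, ‖h x‖ ≤ M

namespace HasFourierNormLE

theorem mono {u : ℝ → ℂ} {M N : ℝ} (hu : HasFourierNormLE u M) (h : M ≤ N) :
    HasFourierNormLE u N := by
  obtain ⟨f, hf, hfu, hM⟩ := hu
  exact ⟨f, hf, hfu, hM.trans h⟩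

theorem norm_le {u : ℝ → ℂ} {M : ℝ} (hu : HasFourierNormLE u M) (x : ℝ) : ‖u x‖ ≤ M := by
  obtain ⟨f, hf, rfl, hM⟩ := hu
  exact (VectorFourier.norm_fourierIntegral_le_integral_norm _ _ _ f x).trans hM

theorem add {u v : ℝ → ℂ} {M N : ℝ} (hu : HasFourierNormLE u M) (hv : HasFourierNormLE v N) :
    HasFourierNormLE (fun x => u x + v x) (M + N) := by
  obtain ⟨f, hf, rfl, hM⟩ := hu
  obtain ⟨g, hg, rfl, hN⟩ := hv
  refine ⟨fun x => f x + g x, hf.add hg, ?_, ?_⟩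
  · funext x
    simp only [Real.fourier_eq]
    rw [← integral_add ((Real.fourierIntegral_convergent_iff x).2 hf)
      ((Real.fourierIntegral_convergent_iff x).2 hg)]
    simp [smul_add]
  · calc ∫ x, ‖f x + g x‖ ≤ ∫ x, (‖f x‖ + ‖g x‖) :=
          integral_mono (hf.add hg).norm (hf.norm.add hg.norm) fun x => norm_add_le _ _
      _ ≤ M + N := by rw [integral_add hf.norm hg.norm]; linarith

theorem const_mul {u : ℝ → ℂ} {M : ℝ} (hu : HasFourierNormLE u M) (c : ℂ) :
    HasFourierNormLE (fun x => c * u x) (‖c‖ * M) := by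
  obtain ⟨f, hf, rfl, hM⟩ := hu
  refine ⟨fun x => c * f x, hf.const_mul c, ?_, ?_⟩
  · funext x
    simp only [Real.fourier_eq]
    rw [← integral_const_mul]
    congr 1 with y
    simp only [Circle.smul_def, smul_eq_mul]
    ring
  · simp only [norm_mul]
    rw [integral_const_mul]
    gcongr

theorem mul {u v : ℝ → ℂ} {M N : ℝ} (hu : HasFourierNormLE u M) (hv : HasFourierNormLE v N) :
    HasFourierNormLE (fun x => u x * v x) (M * N) := by
  obtain ⟨f, hf, rfl, hM⟩ := hu
  obtain ⟨g, hg, rfl, hN⟩ := hv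
  refine ⟨f ⋆[ContinuousLinearMap.mul ℂ ℂ] g, hf.integrable_convolution _ hg, ?_, ?_⟩
  · funext x
    exact Real.fourier_mul_convolution_eq hf hg x
  · have h1 := hf.norm.integrable_convolution (ContinuousLinearMap.mul ℝ ℝ) hg.norm
    have h2 := integral_convolution (ContinuousLinearMap.mul ℝ ℝ) hf.norm hg.norm
    calc ∫ x, ‖(f ⋆[ContinuousLinearMap.mul ℂ ℂ] g) x‖
        ≤ ∫ x, ((fun x => ‖f x‖) ⋆[ContinuousLinearMap.mul ℝ ℝ] fun x => ‖g x‖) x := by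
          refine integral_mono (hf.integrable_convolution _ hg).norm h1 fun x => ?_
          simp only [convolution]
          refine (norm_integral_le_integral_norm _).trans (le_of_eq ?_)
          simp
      _ = (∫ x, ‖f x‖) * ∫ x, ‖g x‖ := by rw [h2]; simp
      _ ≤ M * N := by
          have h0 : 0 ≤ ∫ x, ‖f x‖ := integral_nonneg fun x => norm_nonneg _
          have h0' : 0 ≤ M := h0.trans hM
          gcongr

theorem pow_succ {u : ℝ → ℂ} {M : ℝ} (hu : HasFourierNormLE u M) (n : ℕ) :
    HasFourierNormLE (fun x => u x ^ (n + 1)) (M ^ (n + 1)) := by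
  induction n with
  | zero => simpa using hu
  | succ n ih =>
    simp only [_root_.pow_succ _ (n + 1)]
    exact ih.mul hu

/-- An absolutely convergent series of Fourier transforms is a Fourier transform. -/
theorem exists_tsum {u : ℕ → ℝ → ℂ} {M : ℕ → ℝ} (hu : ∀ n, HasFourierNormLE (u n) (M n))
    (hM : Summable M) :
    ∃ h : ℝ → ℂ, Integrable h ∧ ∀ x, 𝓕 h x = ∑' n, u n x := by
  choose h hi hF hn using hu
  have hs : Summable fun n => ∫ x, ‖h n x‖ :=
    Summable.of_nonneg_of_le (fun n => integral_nonneg fun x => norm_nonneg _) hn hM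
  have hfin : ∑' n, eLpNorm (h n) 1 ≠ ∞ := by
    have : ∀ n, eLpNorm (h n) 1 = ENNReal.ofReal (∫ x, ‖h n x‖) := fun n => by
      rw [eLpNorm_one_eq_lintegral_enorm, ofReal_integral_norm_eq_lintegral_enorm (hi n)]
    simp_rw [this]
    exact hs.tsum_ofReal_ne_top
  have hsum := summable_norm_of_tsum_eLpNorm_ne_top le_rfl (fun n => (hi n).1) hfin
  refine ⟨fun x => ∑' n, h n x, ?_, fun x => ?_⟩
  · refine ⟨?_, ?_⟩
    · refine aestronglyMeasurable_of_tendsto_ae (u := atTop)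
        (f := fun N x => ∑ n ∈ Finset.range N, h n x) ?_ ?_
      · intro N
        exact Finset.aestronglyMeasurable_fun_sum _ fun n _ => (hi n).1
      · filter_upwards [hsum] with x hx
        exact hx.of_norm.hasSum.tendsto_sum_nat
    · rw [hasFiniteIntegral_iff_enorm]
      refine lt_of_le_of_lt (b := ∫⁻ x, ∑' n, ‖h n x‖ₑ) ?_ ?_
      · exact lintegral_mono fun x => enorm_tsum_le_tsum_enorm
      · rw [lintegral_tsum fun n => (hi n).1.enorm]
        simp_rw [← eLpNorm_one_eq_lintegral_enorm]
        exact hfin.lt_top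
  · have hi' := fun n => (Real.fourierIntegral_convergent_iff (f := h n) x).2 (hi n)
    have := integral_tsum_of_summable_integral_norm hi' (by simpa using hs)
    simp_rw [Real.fourier_eq, ← hF, Real.fourier_eq]
    rw [this]
    refine integral_congr_ae ?_
    filter_upwards [hsum] with y hy
    simp only [Circle.smul_def]
    rw [← hy.of_norm.tsum_const_smul]

/-- A function with two integrable derivatives is a Fourier transform. -/
theorem of_hasDerivAt {u u' u'' : ℝ → ℂ} (h1 : ∀ x, HasDerivAt u (u' x) x)
    (h2 : ∀ x, HasDerivAt u' (u'' x) x) (hu : Integrable u) (hu' : Integrable u')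
    (hu'' : Integrable u'') :
    HasFourierNormLE u (((∫ x, ‖u x‖) + ∫ x, ‖u'' x‖) * Real.pi) := by
  set A := ∫ x, ‖u x‖ with hA
  set B := ∫ x, ‖u'' x‖ with hB
  have hd1 : deriv u = u' := funext fun x => (h1 x).deriv
  have hd2 : deriv u' = u'' := funext fun x => (h2 x).deriv
  have hF2 : ∀ x : ℝ, 𝓕 u'' x = (2 * Real.pi * Complex.I * x) ^ 2 * 𝓕 u x := by
    intro x
    rw [← hd2, Real.fourier_deriv hu' (fun x => (h2 x).differentiableAt) (by rwa [hd2]), ← hd1,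
      Real.fourier_deriv hu (fun x => (h1 x).differentiableAt) (by rwa [hd1])]
    simp only [smul_eq_mul]
    ring
  have hbound : ∀ x : ℝ, ‖𝓕 u x‖ ≤ (A + B) * (1 + x ^ 2)⁻¹ := by
    intro x
    have ha : ‖𝓕 u x‖ ≤ A := VectorFourier.norm_fourierIntegral_le_integral_norm _ _ _ u x
    have hb : ‖𝓕 u'' x‖ ≤ B := VectorFourier.norm_fourierIntegral_le_integral_norm _ _ _ u'' x
    have hn : ‖((2 : ℂ) * Real.pi * Complex.I * x) ^ 2‖ = (2 * Real.pi) ^ 2 * x ^ 2 := by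
      simp [mul_pow]
    rw [hF2, norm_mul, hn] at hb
    have hpi : 1 ≤ (2 * Real.pi) ^ 2 := by nlinarith [Real.pi_gt_three]
    rw [← div_eq_mul_inv, le_div_iff₀ (by positivity)]
    nlinarith [mul_le_mul_of_nonneg_right hpi (mul_nonneg (sq_nonneg x) (norm_nonneg (𝓕 u x)))]
  have hcont : Continuous (𝓕 u) :=
    VectorFourier.fourierIntegral_continuous Real.continuous_fourierChar
      (by exact continuous_inner) hu
  have hint : Integrable (𝓕 u) :=
    (integrable_inv_one_add_sq.const_mul (A + B)).mono' hcont.aestronglyMeasurable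
      (Eventually.of_forall hbound)
  have huc : Continuous u := continuous_iff_continuousAt.2 fun x => (h1 x).continuousAt
  refine ⟨𝓕⁻ u, ?_, huc.fourier_fourierInv_eq hu hint, ?_⟩
  · have : 𝓕⁻ u = fun x => 𝓕 u (-x) := funext fun x => Real.fourierInv_eq_fourier_neg u x
    rw [this]
    exact hint.comp_neg
  · calc ∫ x, ‖𝓕⁻ u x‖ = ∫ x, ‖𝓕 u (-x)‖ := by simp_rw [Real.fourierInv_eq_fourier_neg]
      _ = ∫ x, ‖𝓕 u x‖ := integral_neg_eq_self (fun x => ‖𝓕 u x‖) volume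
      _ ≤ ∫ x : ℝ, (A + B) * (1 + x ^ 2)⁻¹ :=
          integral_mono hint.norm (integrable_inv_one_add_sq.const_mul _) hbound
      _ = (A + B) * Real.pi := by rw [integral_const_mul, integral_univ_inv_one_add_sq]

end HasFourierNormLE

theorem _root_.SchwartzMap.hasFourierNormLE (s : 𝓢(ℝ, ℂ)) : ∃ M, HasFourierNormLE s M :=
  ⟨_, (𝓕⁻ s : 𝓢(ℝ, ℂ)), (𝓕⁻ s : 𝓢(ℝ, ℂ)).integrable, by
    rw [← SchwartzMap.fourier_coe, FourierTransform.fourier_fourierInv_eq], le_rfl⟩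

/-- Up to a small `L¹`-error, the Fourier transform of an integrable function is a Schwartz
function. -/
theorem exists_schwartz_hasFourierNormLE_sub {g : ℝ → ℂ} (hg : Integrable g) {ε : ℝ} (hε : 0 < ε) :
    ∃ s : 𝓢(ℝ, ℂ), HasFourierNormLE (fun x => 𝓕 g x - s x) ε := by
  obtain ⟨φ, h1, h2, h3⟩ := (memLp_one_iff_integrable.2 hg).exist_eLpNorm_sub_le
    ENNReal.one_ne_top le_rfl hε
  set φs := h1.toSchwartzMap h2 with hφs
  have hφ : Integrable φ := φs.integrable
  refine ⟨𝓕 φs, g - φ, hg.sub hφ, ?_, ?_⟩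
  · funext x
    rw [SchwartzMap.fourier_coe]
    simp only [Real.fourier_eq]
    rw [← integral_sub ((Real.fourierIntegral_convergent_iff x).2 hg)
      ((Real.fourierIntegral_convergent_iff x).2 φs.integrable)]
    simp [smul_sub, hφs]
  · rw [eLpNorm_one_eq_lintegral_enorm,
      ← ofReal_integral_norm_eq_lintegral_enorm (hg.sub hφ)] at h3
    exact (ENNReal.ofReal_le_ofReal_iff hε.le).1 h3

end

section

open scoped FourierTransform SchwartzMap

/-! ### Logarithms in the Wiener algebra -/

theorem continuous_fourier {g : ℝ → ℂ} (hg : Integrable g) : Continuous (𝓕 g) :=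
  VectorFourier.fourierIntegral_continuous Real.continuous_fourierChar
    (by exact continuous_inner) hg

theorem exists_pos_le_norm_add_fourier {g : ℝ → ℂ} (hg : Integrable g) {p : ℂ} (hp : p ≠ 0)
    (hne : ∀ x, p + 𝓕 g x ≠ 0) : ∃ m > 0, m ≤ ‖p‖ ∧ ∀ x, m ≤ ‖p + 𝓕 g x‖ := by
  have hcont : Continuous fun x => ‖p + 𝓕 g x‖ := by
    have := continuous_fourier hg
    fun_prop
  have hlim : Tendsto (fun x => ‖p + 𝓕 g x‖) (cocompact ℝ) (𝓝 ‖p‖) := by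
    have := ((Real.zero_at_infty_fourier g).const_add p).norm
    simpa using this
  have hp' : 0 < ‖p‖ := norm_pos_iff.2 hp
  have hev := hlim.eventually_const_le (half_lt_self hp')
  obtain ⟨K, hK, hKs⟩ := mem_cocompact.1 hev
  rcases K.eq_empty_or_nonempty with rfl | hne'
  · refine ⟨‖p‖ / 2, by positivity, by linarith, fun x => ?_⟩
    exact hKs (by simp)
  · obtain ⟨x₀, -, hx₀⟩ := hK.exists_isMinOn hne' hcont.continuousOn
    have hpos : 0 < ‖p + 𝓕 g x₀‖ := norm_pos_iff.2 (hne x₀)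
    refine ⟨min (‖p‖ / 2) ‖p + 𝓕 g x₀‖, by positivity, (min_le_left _ _).trans (by linarith),
      fun x => ?_⟩
    by_cases hx : x ∈ K
    · exact (min_le_right _ _).trans (hx₀ hx)
    · exact (min_le_left _ _).trans (hKs hx)

theorem norm_pow_sub_pow_le {w q : ℂ} {K d : ℝ} (hw : ‖w‖ ≤ K) (hq : ‖q‖ ≤ K)
    (hd : ‖w - q‖ ≤ K ^ 2 * d) (n : ℕ) : ‖w ^ n - q ^ n‖ ≤ n * K ^ (n + 1) * d := by
  have hK : 0 ≤ K := (norm_nonneg w).trans hw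
  induction n with
  | zero => simp
  | succ n ih =>
    have e : w ^ (n + 1) - q ^ (n + 1) = w * (w ^ n - q ^ n) + (w - q) * q ^ n := by ring
    rw [e]
    calc ‖w * (w ^ n - q ^ n) + (w - q) * q ^ n‖
        ≤ ‖w‖ * ‖w ^ n - q ^ n‖ + ‖w - q‖ * ‖q‖ ^ n := by
          refine (norm_add_le _ _).trans ?_
          rw [norm_mul, norm_mul, norm_pow]
      _ ≤ K * (n * K ^ (n + 1) * d) + K ^ 2 * d * K ^ n := by
          have := (norm_nonneg _).trans hd
          gcongr
      _ = (n + 1 : ℕ) * K ^ (n + 1 + 1) * d := by push_cast; ring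

/-- The powers of `1 / (p + s)`, `s` a Schwartz function, differ from their limit at infinity by
Fourier transforms whose norms grow, up to a factor quadratic in the exponent, no faster than
the supremum norm. -/
theorem exists_hasFourierNormLE_inv_pow_sub (s : 𝓢(ℝ, ℂ)) {p : ℂ} {m : ℝ} (hm : 0 < m)
    (hp : m ≤ ‖p‖) (hs : ∀ x, m ≤ ‖p + s x‖) :
    ∃ C, 0 ≤ C ∧ ∀ n : ℕ, HasFourierNormLE (fun x => (p + s x)⁻¹ ^ n - p⁻¹ ^ n)
      (C * (n * (n + 1)) * m⁻¹ ^ n) := by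
  set K := m⁻¹ with hK
  have hK0 : 0 ≤ K := by positivity
  set s1 := SchwartzMap.derivCLM ℂ ℂ s with hs1
  set s2 := SchwartzMap.derivCLM ℂ ℂ s1 with hs2
  have hd0 : ∀ x, HasDerivAt s (s1 x) x := fun x => s.hasDerivAt x
  have hd1 : ∀ x, HasDerivAt s1 (s2 x) x := fun x => s1.hasDerivAt x
  obtain ⟨B, hB0, hB⟩ : ∃ B, 0 ≤ B ∧ ∀ x, ‖s1 x‖ ≤ B := by
    obtain ⟨M, hM⟩ := s1.hasFourierNormLE
    exact ⟨M, (norm_nonneg _).trans (hM.norm_le 0), hM.norm_le⟩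
  set S0 := ∫ x, ‖s x‖ with hS0
  set S1 := ∫ x, ‖s1 x‖ with hS1
  set S2 := ∫ x, ‖s2 x‖ with hS2
  have hS0' : 0 ≤ S0 := integral_nonneg fun x => norm_nonneg _
  have hS1' : 0 ≤ S1 := integral_nonneg fun x => norm_nonneg _
  have hS2' : 0 ≤ S2 := integral_nonneg fun x => norm_nonneg _
  set w : ℝ → ℂ := fun x => (p + s x)⁻¹ with hw
  have hne : ∀ x, p + s x ≠ 0 := fun x => norm_pos_iff.1 (hm.trans_le (hs x))
  have hwK : ∀ x, ‖w x‖ ≤ K := fun x => by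
    rw [hw, norm_inv]; exact inv_anti₀ hm (hs x)
  have hqK : ‖p⁻¹‖ ≤ K := by rw [norm_inv]; exact inv_anti₀ hm hp
  have hp0 : p ≠ 0 := norm_pos_iff.1 (hm.trans_le hp)
  have hwq : ∀ x, ‖w x - p⁻¹‖ ≤ K ^ 2 * ‖s x‖ := fun x => by
    have : w x - p⁻¹ = -(w x * p⁻¹ * s x) := by
      have := hne x
      simp only [hw]; field_simp; ring
    rw [this, norm_neg, norm_mul, norm_mul, sq]
    gcongr
    exact hwK x
  have hdw : ∀ x, HasDerivAt w (-s1 x * w x ^ 2) x := fun x => by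
    have h : HasDerivAt w _ x := ((hd0 x).const_add p).fun_inv (hne x)
    refine h.congr_deriv ?_
    rw [hw, inv_pow, div_eq_mul_inv]
  have hdpow : ∀ (n : ℕ) x, HasDerivAt (fun y => w y ^ n) (-(n * s1 x * w x ^ (n + 1))) x := by
    intro n x
    refine ((hdw x).fun_pow n).congr_deriv ?_
    cases n with
    | zero => simp
    | succ k => rw [Nat.add_sub_cancel]; ring
  refine ⟨(K * S0 + (K * S2 + K ^ 2 * B * S1)) * Real.pi, by positivity, fun n => ?_⟩
  have e1 : ∀ x, HasDerivAt (fun x => w x ^ n - p⁻¹ ^ n) (-(n * s1 x * w x ^ (n + 1))) x :=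
    fun x => (hdpow n x).sub_const _
  have e2 : ∀ x, HasDerivAt (fun x => -(n * s1 x * w x ^ (n + 1)))
      (-(n * s2 x * w x ^ (n + 1)) + n * (n + 1) * s1 x ^ 2 * w x ^ (n + 2)) x := fun x => by
    refine (((hd1 x).const_mul (n : ℂ)).fun_mul (hdpow (n + 1) x)).fun_neg.congr_deriv ?_
    push_cast; ring
  have hcw : Continuous w := continuous_iff_continuousAt.2 fun x => (hdw x).continuousAt
  have b0 : ∀ x, ‖w x ^ n - p⁻¹ ^ n‖ ≤ n * K ^ (n + 1) * ‖s x‖ := fun x =>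
    norm_pow_sub_pow_le (hwK x) hqK (hwq x) n
  have b1 : ∀ x, ‖-(n * s1 x * w x ^ (n + 1))‖ ≤ n * K ^ (n + 1) * ‖s1 x‖ := fun x => by
    rw [norm_neg, norm_mul, norm_mul, norm_pow, Complex.norm_natCast]
    have := pow_le_pow_left₀ (norm_nonneg _) (hwK x) (n + 1)
    calc n * ‖s1 x‖ * ‖w x‖ ^ (n + 1) ≤ n * ‖s1 x‖ * K ^ (n + 1) := by gcongr
      _ = _ := by ring
  have b2 : ∀ x, ‖-(n * s2 x * w x ^ (n + 1)) + n * (n + 1) * s1 x ^ 2 * w x ^ (n + 2)‖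
      ≤ n * K ^ (n + 1) * ‖s2 x‖ + n * (n + 1) * K ^ (n + 2) * B * ‖s1 x‖ := fun x => by
    refine (norm_add_le _ _).trans ?_
    have hn1 : ‖((n : ℂ) + 1)‖ = n + 1 := by
      rw [← Nat.cast_succ, Complex.norm_natCast]; simp
    rw [norm_neg, norm_mul, norm_mul, norm_pow, norm_mul, norm_mul, norm_mul, norm_pow, norm_pow,
      Complex.norm_natCast, hn1]
    have h1 := pow_le_pow_left₀ (norm_nonneg _) (hwK x) (n + 1)
    have h2 := pow_le_pow_left₀ (norm_nonneg _) (hwK x) (n + 2)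
    refine add_le_add ?_ ?_
    · calc n * ‖s2 x‖ * ‖w x‖ ^ (n + 1) ≤ n * ‖s2 x‖ * K ^ (n + 1) := by gcongr
        _ = _ := by ring
    · calc (n : ℝ) * (n + 1) * ‖s1 x‖ ^ 2 * ‖w x‖ ^ (n + 2)
          ≤ n * (n + 1) * (B * ‖s1 x‖) * K ^ (n + 2) := by
            rw [sq]; gcongr; exact hB x
        _ = _ := by ring
  have i0 : Integrable fun x => w x ^ n - p⁻¹ ^ n :=
    (s.integrable.norm.const_mul (n * K ^ (n + 1))).mono'
      (by fun_prop) (Eventually.of_forall b0)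
  have i1 : Integrable fun x => -(n * s1 x * w x ^ (n + 1)) :=
    (s1.integrable.norm.const_mul (n * K ^ (n + 1))).mono'
      (by have := s1.continuous; fun_prop) (Eventually.of_forall b1)
  have i2r : Integrable fun x =>
      n * K ^ (n + 1) * ‖s2 x‖ + n * (n + 1) * K ^ (n + 2) * B * ‖s1 x‖ :=
    (s2.integrable.norm.const_mul (n * K ^ (n + 1))).add
      (s1.integrable.norm.const_mul (n * (n + 1) * K ^ (n + 2) * B))
  have i2 : Integrable fun x =>
      -(n * s2 x * w x ^ (n + 1)) + n * (n + 1) * s1 x ^ 2 * w x ^ (n + 2) :=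
    i2r.mono' (by have := s1.continuous; have := s2.continuous; fun_prop)
      (Eventually.of_forall b2)
  refine (HasFourierNormLE.of_hasDerivAt e1 e2 i0 i1 i2).mono ?_
  have c0 : ∫ x, ‖w x ^ n - p⁻¹ ^ n‖ ≤ n * K ^ (n + 1) * S0 := by
    rw [hS0, ← integral_const_mul]
    exact integral_mono i0.norm (s.integrable.norm.const_mul _) b0
  have c2 : ∫ x, ‖-(n * s2 x * w x ^ (n + 1)) + n * (n + 1) * s1 x ^ 2 * w x ^ (n + 2)‖
      ≤ n * K ^ (n + 1) * S2 + n * (n + 1) * K ^ (n + 2) * B * S1 := by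
    rw [hS2, hS1, ← integral_const_mul, ← integral_const_mul, ← integral_add
      (s2.integrable.norm.const_mul _) (s1.integrable.norm.const_mul _)]
    exact integral_mono i2.norm i2r b2
  have hn : (n : ℝ) ≤ n * (n + 1) := by nlinarith [(Nat.cast_nonneg n : (0 : ℝ) ≤ n)]
  calc ((∫ x, ‖w x ^ n - p⁻¹ ^ n‖)
        + ∫ x, ‖-(n * s2 x * w x ^ (n + 1)) + n * (n + 1) * s1 x ^ 2 * w x ^ (n + 2)‖) * Real.pi
      ≤ (n * K ^ (n + 1) * S0
        + (n * K ^ (n + 1) * S2 + n * (n + 1) * K ^ (n + 2) * B * S1)) * Real.pi := by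
        gcongr
    _ ≤ ((n * (n + 1)) * K ^ (n + 1) * S0
        + ((n * (n + 1)) * K ^ (n + 1) * S2 + n * (n + 1) * K ^ (n + 2) * B * S1)) * Real.pi := by
        gcongr
    _ = _ := by ring

/-- A non-vanishing function `p + s`, `s` a Schwartz function, is the exponential of a function
whose derivative is a Fourier transform. The logarithm need not have equal limits at `±∞`. -/
theorem exists_add_schwartz_eq_exp (s : 𝓢(ℝ, ℂ)) {p : ℂ} {m : ℝ} (hm : 0 < m)
    (hp : m ≤ ‖p‖) (hs : ∀ x, m ≤ ‖p + s x‖) :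
    ∃ (c : ℂ) (ψ : ℝ → ℂ), Integrable ψ ∧
      ∀ x, p + s x = Complex.exp (c + ∫ t in (0 : ℝ)..x, 𝓕 ψ t) := by
  have hne : ∀ x, p + s x ≠ 0 := fun x => norm_pos_iff.1 (hm.trans_le (hs x))
  set s1 := SchwartzMap.derivCLM ℂ ℂ s with hs1
  obtain ⟨C, -, hC⟩ := exists_hasFourierNormLE_inv_pow_sub s hm hp hs
  obtain ⟨M, hM⟩ := s1.hasFourierNormLE
  obtain ⟨ψ, hψ, hψF, -⟩ := (hM.mul (hC 1)).add (hM.const_mul p⁻¹)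
  have hF : ∀ x, 𝓕 ψ x = s1 x / (p + s x) := fun x => by
    rw [hψF]; simp only [pow_one]; rw [div_eq_mul_inv]; ring
  obtain ⟨c, hc⟩ : ∃ c, Complex.exp c = p + s 0 := ⟨_, Complex.exp_log (hne 0)⟩
  refine ⟨c, ψ, hψ, ?_⟩
  have hcont := continuous_fourier hψ
  set l : ℝ → ℂ := fun x => c + ∫ t in (0 : ℝ)..x, 𝓕 ψ t with hl
  have hdl : ∀ x, HasDerivAt l (𝓕 ψ x) x := fun x =>
    (intervalIntegral.integral_hasDerivAt_right (hcont.intervalIntegrable _ _)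
      (hcont.stronglyMeasurableAtFilter _ _) hcont.continuousAt).const_add c
  have hd : ∀ x, HasDerivAt (fun x => (p + s x) * Complex.exp (-l x)) 0 x := fun x => by
    refine (((s.hasDerivAt x).const_add p).fun_mul ((hdl x).fun_neg.cexp)).congr_deriv ?_
    have h1 : s1 x = deriv s x := rfl
    rw [hF, h1]
    field_simp [hne x]
    ring
  have hconst := is_const_of_deriv_eq_zero (fun x => (hd x).differentiableAt)
    (fun x => (hd x).deriv)
  intro x
  have h0 := hconst x 0
  have hl0 : l 0 = c := by simp [hl]
  rw [hl0, ← hc, ← Complex.exp_add, add_neg_cancel, Complex.exp_zero] at h0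
  calc p + s x = (p + s x) * Complex.exp (-l x) * Complex.exp (l x) := by
        rw [mul_assoc, ← Complex.exp_add, neg_add_cancel, Complex.exp_zero, mul_one]
    _ = Complex.exp (l x) := by rw [h0, one_mul]

/-- **Wiener–Lévy theorem for the logarithm**: a non-vanishing function `p + 𝓕 g` with `p ≠ 0` and
`g` integrable is the exponential of a constant plus a Fourier transform plus a primitive of a
Fourier transform. -/
theorem exists_add_fourier_eq_exp {g : ℝ → ℂ} (hg : Integrable g) {p : ℂ} (hp : p ≠ 0)
    (hne : ∀ x, p + 𝓕 g x ≠ 0) :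
    ∃ (c : ℂ) (h ψ : ℝ → ℂ), Integrable h ∧ Integrable ψ ∧
      ∀ x, p + 𝓕 g x = Complex.exp (c + 𝓕 h x + ∫ t in (0 : ℝ)..x, 𝓕 ψ t) := by
  obtain ⟨m₀, hm₀, hmp, hmF⟩ := exists_pos_le_norm_add_fourier hg hp hne
  obtain ⟨s, hs⟩ := exists_schwartz_hasFourierNormLE_sub hg (ε := m₀ / 4) (by positivity)
  set d : ℝ → ℂ := fun x => 𝓕 g x - s x with hd
  set m := 3 * m₀ / 4 with hm
  have hm0 : 0 < m := by positivity
  have hpm : m ≤ ‖p‖ := by linarith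
  have hPm : ∀ x, m ≤ ‖p + s x‖ := fun x => by
    have h1 := hs.norm_le x
    have h2 := hmF x
    have h3 : p + 𝓕 g x = (p + s x) + d x := by simp [hd]
    have h4 := norm_add_le (p + s x) (d x)
    rw [h3] at h2
    linarith
  have hPne : ∀ x, p + s x ≠ 0 := fun x => norm_pos_iff.1 (hm0.trans_le (hPm x))
  obtain ⟨c, ψ, hψ, hc⟩ := exists_add_schwartz_eq_exp s hm0 hpm hPm
  obtain ⟨C, hC0, hC⟩ := exists_hasFourierNormLE_inv_pow_sub s hm0 hpm hPm
  have hratio : m₀ / 4 * m⁻¹ = 1 / 3 := by rw [hm]; field_simp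
  -- the terms of the logarithmic series of `1 + d / (p + s)`
  have hterm : ∀ n : ℕ, HasFourierNormLE
      (fun x => (-1) ^ (n + 1 + 1) * (d x / (p + s x)) ^ (n + 1) / ((n + 1 : ℕ) : ℂ))
      ((1 + C * ((n + 1) * (n + 2))) * (1 / 3) ^ (n + 1)) := by
    intro n
    have h1 := hs.pow_succ n
    have h2 := ((h1.mul (hC (n + 1))).add (h1.const_mul (p⁻¹ ^ (n + 1)))).const_mul
      ((-1) ^ (n + 1 + 1) / ((n + 1 : ℕ) : ℂ))
    have hfun : (fun x => (-1) ^ (n + 1 + 1) * (d x / (p + s x)) ^ (n + 1) / ((n + 1 : ℕ) : ℂ))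
        = fun x => (-1) ^ (n + 1 + 1) / ((n + 1 : ℕ) : ℂ) * ((𝓕 g x - s x) ^ (n + 1)
          * ((p + s x)⁻¹ ^ (n + 1) - p⁻¹ ^ (n + 1))
          + p⁻¹ ^ (n + 1) * (𝓕 g x - s x) ^ (n + 1)) := by
      funext x
      rw [div_eq_mul_inv (d x), mul_pow]
      ring
    rw [hfun]
    refine h2.mono ?_
    have hcoef : ‖(-1) ^ (n + 1 + 1) / ((n + 1 : ℕ) : ℂ)‖ ≤ 1 := by
      rw [norm_div, norm_pow, norm_neg, norm_one, one_pow, Complex.norm_natCast]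
      rw [div_le_one (by positivity)]
      push_cast; linarith [(Nat.cast_nonneg n : (0 : ℝ) ≤ n)]
    have hpinv : ‖p⁻¹ ^ (n + 1)‖ ≤ m⁻¹ ^ (n + 1) := by
      rw [norm_pow, norm_inv]
      gcongr
    calc _ ≤ 1 * ((m₀ / 4) ^ (n + 1) * (C * (((n + 1 : ℕ) : ℝ) * ((n + 1 : ℕ) + 1)) * m⁻¹ ^ (n + 1))
            + m⁻¹ ^ (n + 1) * (m₀ / 4) ^ (n + 1)) := by
          gcongr
      _ = (1 + C * ((n + 1) * (n + 2))) * (m₀ / 4 * m⁻¹) ^ (n + 1) := by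
          rw [mul_pow]; push_cast; ring
      _ = _ := by rw [hratio]
  have hsum : Summable fun n : ℕ => (1 + C * (((n : ℝ) + 1) * (n + 2))) * (1 / 3 : ℝ) ^ (n + 1) := by
    have h0 := summable_pow_mul_geometric_of_norm_lt_one (r := (1 / 3 : ℝ)) 0 (by norm_num)
    have h1 := summable_pow_mul_geometric_of_norm_lt_one (r := (1 / 3 : ℝ)) 1 (by norm_num)
    have h2 := summable_pow_mul_geometric_of_norm_lt_one (r := (1 / 3 : ℝ)) 2 (by norm_num)
    refine (((h0.mul_left ((1 + 2 * C) / 3)).add (h1.mul_left (C))).add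
      (h2.mul_left (C / 3))).congr fun n => ?_
    ring
  obtain ⟨h, hh, hhF⟩ := HasFourierNormLE.exists_tsum hterm hsum
  refine ⟨c, h, ψ, hh, hψ, fun x => ?_⟩
  have hlt : ‖d x / (p + s x)‖ < 1 := by
    rw [norm_div, div_lt_one (hm0.trans_le (hPm x))]
    have := hs.norm_le x
    exact lt_of_le_of_lt this (lt_of_lt_of_le (by rw [hm]; linarith) (hPm x))
  have hlog : 𝓕 h x = Complex.log (1 + d x / (p + s x)) := by
    rw [hhF, ← (Complex.hasSum_taylorSeries_log hlt).tsum_eq,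
      (Complex.hasSum_taylorSeries_log hlt).summable.tsum_eq_zero_add]
    simp
  have h1 : 1 + d x / (p + s x) = (p + 𝓕 g x) / (p + s x) := by
    have := hPne x
    rw [hd]; field_simp; ring
  have h2 : (p + 𝓕 g x) / (p + s x) ≠ 0 := div_ne_zero (hne x) (hPne x)
  rw [add_right_comm, Complex.exp_add, ← hc, hlog, h1, Complex.exp_log h2,
    mul_div_cancel₀ _ (hPne x)]

end

section

open scoped FourierTransform ComplexConjugate

/-! ### Non-vanishing perturbations of a point mass -/

theorem fourier_neg_two_pi_inv_mul (h : ℝ → ℂ) (z : ℝ) :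
    𝓕 h (-(2 * Real.pi)⁻¹ * z) = ∫ x : ℝ, Complex.exp (Complex.I * x * z) * h x := by
  rw [Real.fourier_eq']
  refine integral_congr_ae (Eventually.of_forall fun x => ?_)
  have hpi : (Real.pi : ℂ) ≠ 0 := by exact_mod_cast Real.pi_ne_zero
  simp only [smul_eq_mul, RCLike.inner_apply, conj_trivial]
  congr 2
  push_cast
  field_simp

theorem integrable_exp_mul {h : ℝ → ℂ} (hh : Integrable h) (z : ℝ) :
    Integrable fun x : ℝ => Complex.exp (Complex.I * x * z) * h x := by
  refine hh.bdd_mul (c := 1) (by fun_prop) (Eventually.of_forall fun x => ?_)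
  rw [mul_assoc, mul_comm, ← Complex.ofReal_mul, Complex.norm_exp_ofReal_mul_I]

theorem intervalIntegral_fourier_eq {ψ : ℝ → ℂ} (hψ : Integrable ψ) (z : ℝ) :
    ∫ t in (0 : ℝ)..(-(2 * Real.pi)⁻¹ * z), 𝓕 ψ t
      = ∫ x : ℝ, (Complex.exp (Complex.I * x * z) - 1) * (ψ x / (-2 * Real.pi * Complex.I * x)) := by
  have hF : ∀ t, 𝓕 ψ t = ∫ x : ℝ, Complex.exp (-2 * Real.pi * Complex.I * x * t) * ψ x := by
    intro t
    rw [Real.fourier_eq']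
    refine integral_congr_ae (Eventually.of_forall fun x => ?_)
    simp only [smul_eq_mul, RCLike.inner_apply, conj_trivial]
    congr 2
    push_cast
    ring
  simp_rw [hF]
  rw [intervalIntegral_integral_swap]
  · have hne : ∀ᵐ x : ℝ, x ≠ 0 := by simp [ae_iff]
    refine integral_congr_ae ?_
    filter_upwards [hne] with x hx
    have hx' : (x : ℂ) ≠ 0 := by exact_mod_cast hx
    have hpi : (Real.pi : ℂ) ≠ 0 := by exact_mod_cast Real.pi_ne_zero
    have hc : -2 * (Real.pi : ℂ) * Complex.I * x ≠ 0 := by simp [hx, Real.pi_ne_zero]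
    rw [intervalIntegral.integral_mul_const, integral_exp_mul_complex hc]
    have e : -2 * (Real.pi : ℂ) * Complex.I * x * ((-(2 * Real.pi)⁻¹ * z : ℝ) : ℂ)
        = Complex.I * x * z := by
      push_cast; field_simp
    rw [e]
    simp only [Complex.ofReal_zero, mul_zero, Complex.exp_zero]
    ring
  · have : IsFiniteMeasure (volume.restrict (uIoc 0 (-(2 * Real.pi)⁻¹ * z))) :=
      ⟨by rw [Measure.restrict_apply_univ]; exact measure_Ioc_lt_top⟩
    have h1 : Integrable (fun q : ℝ × ℝ => ψ q.2)
        ((volume.restrict (uIoc 0 (-(2 * Real.pi)⁻¹ * z))).prod volume) := hψ.comp_snd _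
    refine h1.bdd_mul (c := 1) (by fun_prop) (Eventually.of_forall fun q => ?_)
    have : -2 * (Real.pi : ℂ) * Complex.I * q.2 * q.1
        = ((-2 * Real.pi * q.2 * q.1 : ℝ) : ℂ) * Complex.I := by
      push_cast; ring
    simp only [this, Complex.norm_exp_ofReal_mul_I, le_refl]

theorem norm_exp_I_mul_sub_one_le_min (x z : ℝ) :
    ‖Complex.exp (Complex.I * x * z) - 1‖ ≤ (2 + |z|) * min 1 |x| := by
  rcases le_total 1 |x| with h | h
  · rw [min_eq_left h]
    linarith [norm_exp_I_mul_sub_one_le_two x z, abs_nonneg z]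
  · rw [min_eq_right h]
    nlinarith [norm_exp_I_mul_sub_one_le x z, abs_nonneg x]

section

variable {n : ℝ → ℂ}

theorem integrable_exp_sub_one_mul (hn : AEStronglyMeasurable n)
    (hi : Integrable fun x : ℝ => min 1 |x| * ‖n x‖) (z : ℝ) :
    Integrable fun x : ℝ => (Complex.exp (Complex.I * x * z) - 1) * n x := by
  refine (hi.const_mul (2 + |z|)).mono' (by fun_prop) (Eventually.of_forall fun x => ?_)
  rw [norm_mul, ← mul_assoc]
  gcongr
  exact norm_exp_I_mul_sub_one_le_min x z

theorem continuous_integral_exp_sub_one_mul (hn : AEStronglyMeasurable n)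
    (hi : Integrable fun x : ℝ => min 1 |x| * ‖n x‖) :
    Continuous fun z : ℝ => ∫ x : ℝ, (Complex.exp (Complex.I * x * z) - 1) * n x := by
  refine continuous_iff_continuousAt.2 fun z₀ => ?_
  refine continuousAt_of_dominated (bound := fun x => (2 + (|z₀| + 1)) * (min 1 |x| * ‖n x‖))
    (Eventually.of_forall fun z => by fun_prop) ?_ (hi.const_mul _)
    (Eventually.of_forall fun x => by fun_prop)
  have : ∀ᶠ z in 𝓝 z₀, |z| < |z₀| + 1 :=
    (continuous_abs.tendsto z₀).eventually_lt_const (by linarith)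
  filter_upwards [this] with z hz
  refine Eventually.of_forall fun x => ?_
  rw [norm_mul, ← mul_assoc]
  gcongr
  refine (norm_exp_I_mul_sub_one_le_min x z).trans ?_
  gcongr

/-- In an exponential representation of a Hermitian function with value `1` at `0`, the density may
be replaced by its real part: `f(z)² = f(z) * conj (f(-z))` doubles the real part, and the sign of
the square root is fixed by continuity. -/
theorem eq_exp_integral_re {f : ℝ → ℂ} (hf : Continuous f) (hf0 : f 0 = 1)
    (hconj : ∀ z, f (-z) = conj (f z)) (hn : AEStronglyMeasurable n)
    (hi : Integrable fun x : ℝ => min 1 |x| * ‖n x‖)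
    (h : ∀ z : ℝ, f z = Complex.exp (∫ x : ℝ, (Complex.exp (Complex.I * x * z) - 1) * n x)) (z : ℝ) :
    f z = Complex.exp (∫ x : ℝ, (Complex.exp (Complex.I * x * z) - 1) * ((n x).re : ℂ)) := by
  have hnr : AEStronglyMeasurable fun x => ((n x).re : ℂ) :=
    (Complex.continuous_ofReal.comp Complex.continuous_re).comp_aestronglyMeasurable hn
  have hnc : AEStronglyMeasurable fun x => conj (n x) :=
    Complex.continuous_conj.comp_aestronglyMeasurable hn
  have hic : Integrable fun x : ℝ => min 1 |x| * ‖conj (n x)‖ := by simpa using hi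
  have hir : Integrable fun x : ℝ => min 1 |x| * ‖((n x).re : ℂ)‖ := by
    refine hi.mono (by fun_prop) (Eventually.of_forall fun x => ?_)
    rw [norm_mul, norm_mul, norm_norm, norm_norm, Complex.norm_real]
    gcongr
    exact Complex.abs_re_le_norm _
  set E : ℝ → ℂ := fun z => ∫ x : ℝ, (Complex.exp (Complex.I * x * z) - 1) * ((n x).re : ℂ) with hE
  have hcE : Continuous E := continuous_integral_exp_sub_one_mul hnr hir
  have hsq : ∀ z, f z ^ 2 = Complex.exp (E z) ^ 2 := by
    intro z
    have h1 : f z = Complex.exp (∫ x : ℝ, (Complex.exp (Complex.I * x * z) - 1) * conj (n x)) := by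
      have h2 := hconj (-z)
      rw [neg_neg] at h2
      rw [h2, h, ← Complex.exp_conj, ← integral_conj]
      congr 2 with x
      simp only [map_mul, map_sub, map_one, ← Complex.exp_conj, Complex.conj_I,
        Complex.conj_ofReal]
      push_cast
      congr 3
      ring
    calc f z ^ 2 = f z * f z := sq _
      _ = Complex.exp ((∫ x : ℝ, (Complex.exp (Complex.I * x * z) - 1) * n x)
          + ∫ x : ℝ, (Complex.exp (Complex.I * x * z) - 1) * conj (n x)) := by
          rw [Complex.exp_add, ← h, ← h1]
      _ = Complex.exp (2 * E z) := by
          rw [← integral_add (integrable_exp_sub_one_mul hn hi z)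
            (integrable_exp_sub_one_mul hnc hic z), hE, ← integral_const_mul]
          congr 2 with x
          rw [← mul_add, Complex.add_conj]
          push_cast; ring
      _ = Complex.exp (E z) ^ 2 := by rw [two_mul, Complex.exp_add, sq]
  have := isPreconnected_univ.eq_of_sq_eq (f := f) (g := fun z => Complex.exp (E z))
    hf.continuousOn (by fun_prop) (fun z _ => hsq z) (fun _ => Complex.exp_ne_zero _)
    (mem_univ 0) (by simp [hf0, hE])
  exact this (mem_univ z)

end

/-- A real density `n` with `∫ (1 ∧ |x|) |n(x)| dx < ∞` is the difference of the densities of two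
Lévy-type measures; the compensator of the Lévy–Khintchine integrand becomes a drift. -/
theorem exists_isLevyType_integral_eq {n : ℝ → ℝ} (hn : AEMeasurable n)
    (hi : Integrable fun x : ℝ => min 1 |x| * |n x|) :
    ∃ (γ : ℝ) (α β : Measure ℝ), IsLevyType α ∧ IsLevyType β ∧ ∀ z : ℝ,
      ∫ x : ℝ, (Complex.exp (Complex.I * x * z) - 1) * (n x : ℂ)
        = Complex.I * γ * z + (∫ x, lkKernel z x ∂α - ∫ x, lkKernel z x ∂β) := by
  have hmin : ∀ x : ℝ, min 1 (x ^ 2) ≤ min 1 |x| := fun x => by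
    rcases le_total 1 |x| with h | h
    · rw [min_eq_left h]; exact min_le_left _ _
    · rw [min_eq_right h]
      refine (min_le_right _ _).trans ?_
      rw [← sq_abs]; nlinarith [abs_nonneg x]
  -- the measure with density `m⁺`, for `m = n` and `m = -n`
  have key : ∀ m : ℝ → ℝ, AEMeasurable m → (∀ x, |m x| = |n x|) →
      IsLevyType (volume.withDensity fun x => ENNReal.ofReal (m x)) ∧
      ∀ z, ∫ x, lkKernel z x ∂(volume.withDensity fun x => ENNReal.ofReal (m x))
        = ∫ x, ((max (m x) 0 : ℝ) : ℂ) * lkKernel z x := by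
    intro m hm hmn
    refine ⟨⟨?_, ?_⟩, fun z => ?_⟩
    · exact withDensity_absolutelyContinuous _ _ (by simp)
    · rw [lintegral_withDensity_eq_lintegral_mul₀ (by fun_prop) (by fun_prop)]
      refine lt_of_le_of_lt (lintegral_mono fun x => ?_) hi.lintegral_lt_top
      simp only [Pi.mul_apply]
      rw [mul_comm, ← ENNReal.ofReal_mul (by positivity)]
      refine ENNReal.ofReal_le_ofReal ?_
      calc min 1 (x ^ 2) * m x ≤ min 1 (x ^ 2) * |n x| := by
            rw [← hmn]; gcongr; exact le_abs_self _
        _ ≤ min 1 |x| * |n x| := by gcongr ?_ * _; exact hmin x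
    · rw [integral_withDensity_eq_integral_toReal_smul₀ (by fun_prop)
        (Eventually.of_forall fun x => ENNReal.ofReal_lt_top)]
      refine integral_congr_ae (Eventually.of_forall fun x => ?_)
      simp only [ENNReal.toReal_ofReal', Complex.real_smul]
  obtain ⟨hα, hα'⟩ := key n hn fun _ => rfl
  obtain ⟨hβ, hβ'⟩ := key (fun x => -n x) hn.neg fun x => abs_neg _
  have hlk : ∀ (z : ℝ) (m : ℝ → ℝ), AEMeasurable m → (∀ x, |m x| ≤ |n x|) →
      Integrable fun x => (m x : ℂ) * lkKernel z x := by
    intro z m hm hmn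
    refine (hi.const_mul (2 + 3 * z ^ 2)).mono' ?_ (Eventually.of_forall fun x => ?_)
    · have := (measurable_lkKernel z).aestronglyMeasurable (μ := volume)
      exact (Complex.measurable_ofReal.comp_aemeasurable hm).aestronglyMeasurable.mul this
    · rw [norm_mul, Complex.norm_real, Real.norm_eq_abs, mul_comm, ← mul_assoc]
      have h1 := norm_lkKernel_le z x
      have h2 : (2 + 3 * z ^ 2) * min 1 (x ^ 2) ≤ (2 + 3 * z ^ 2) * min 1 |x| :=
        mul_le_mul_of_nonneg_left (hmin x) (by positivity)
      have := hmn x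
      have h3 := h1.trans h2
      gcongr
  have hdrift : Integrable fun x => (Icc (-1 : ℝ) 1).indicator (fun x => x * n x) x := by
    refine hi.mono' ((by fun_prop : AEMeasurable fun x => x * n x).indicator
      measurableSet_Icc).aestronglyMeasurable (Eventually.of_forall fun x => ?_)
    by_cases hx : x ∈ Icc (-1 : ℝ) 1
    · rw [indicator_of_mem hx, norm_mul, Real.norm_eq_abs, Real.norm_eq_abs,
        min_eq_right (abs_le.2 hx)]
    · rw [indicator_of_notMem hx, norm_zero]; positivity
  have hplus : ∀ z, Integrable fun x => ((max (n x) 0 : ℝ) : ℂ) * lkKernel z x := fun z => by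
    refine hlk z _ (hn.max aemeasurable_const) fun x => ?_
    rw [abs_of_nonneg (le_max_right _ _)]
    exact max_le (le_abs_self _) (abs_nonneg _)
  have hminus : ∀ z, Integrable fun x => ((max (-n x) 0 : ℝ) : ℂ) * lkKernel z x := fun z => by
    refine hlk z _ (hn.neg.max aemeasurable_const) fun x => ?_
    rw [abs_of_nonneg (le_max_right _ _)]
    exact max_le (neg_le_abs _) (abs_nonneg _)
  refine ⟨∫ x, (Icc (-1 : ℝ) 1).indicator (fun x => x * n x) x, _, _, hα, hβ, fun z => ?_⟩
  rw [hα', hβ', ← integral_sub (hplus z) (hminus z), ← integral_complex_ofReal,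
    mul_right_comm, ← integral_const_mul, ← integral_add (hdrift.ofReal.const_mul _)
      (by exact (hplus z).sub (hminus z))]
  refine integral_congr_ae (Eventually.of_forall fun x => ?_)
  have hmax : ((max (n x) 0 : ℝ) : ℂ) - ((max (-n x) 0 : ℝ) : ℂ) = n x := by
    rw [← Complex.ofReal_sub]
    congr 1
    rcases le_total 0 (n x) with h | h
    · rw [max_eq_left h, max_eq_right (by linarith)]; ring
    · rw [max_eq_right h, max_eq_left (by linarith)]; ring
  simp only [← sub_mul, hmax]
  unfold lkKernel
  by_cases hx : x ∈ Icc (-1 : ℝ) 1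
  · simp only [indicator_of_mem hx]; push_cast; ring
  · simp only [indicator_of_notMem hx]; push_cast; ring

theorem charFun_eq_fourier_rnDeriv {η : Measure ℝ} [IsFiniteMeasure η] (hη : η ≪ volume) (z : ℝ) :
    charFun η z
      = 𝓕 (fun x => ((η.rnDeriv volume x).toReal : ℂ)) (-(2 * Real.pi)⁻¹ * z) := by
  rw [fourier_neg_two_pi_inv_mul, charFun_apply_real, ← integral_rnDeriv_smul hη]
  refine integral_congr_ae (Eventually.of_forall fun x => ?_)
  simp only [Complex.real_smul]
  rw [mul_comm]
  congr 2
  ring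

/-- The characteristic function of `p δ₀ + η`, `η` absolutely continuous, has a Lévy–Khintchine
representation as soon as it does not vanish. -/
theorem exists_add_charFun_eq_exp {η : Measure ℝ} [IsFiniteMeasure η] (hη : η ≪ volume) {p : ℝ}
    (hp : p ≠ 0) (h1 : p + η.real univ = 1) (hne : ∀ z : ℝ, p + charFun η z ≠ 0) :
    ∃ (γ : ℝ) (α β : Measure ℝ), IsLevyType α ∧ IsLevyType β ∧ ∀ z : ℝ,
      p + charFun η z
        = Complex.exp (Complex.I * γ * z + (∫ x, lkKernel z x ∂α - ∫ x, lkKernel z x ∂β)) := by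
  set g : ℝ → ℂ := fun x => ((η.rnDeriv volume x).toReal : ℂ) with hg
  have hgi : Integrable g := Measure.integrable_toReal_rnDeriv.ofReal
  have hpi : (2 * Real.pi) ≠ 0 := by positivity
  have hne' : ∀ x, (p : ℂ) + 𝓕 g x ≠ 0 := fun x => by
    have h2 := hne (-(2 * Real.pi) * x)
    have e : -(2 * Real.pi)⁻¹ * (-(2 * Real.pi) * x) = x := by field_simp
    rwa [charFun_eq_fourier_rnDeriv hη, e] at h2
  obtain ⟨c, h, ψ, hh, hψ, hF⟩ := exists_add_fourier_eq_exp hgi (by exact_mod_cast hp) hne'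
  set n : ℝ → ℂ := fun x => h x + ψ x / (-2 * Real.pi * Complex.I * x) with hn
  have hd : Measurable fun x : ℝ => (-2 * Real.pi * Complex.I * x : ℂ) := by fun_prop
  have hψm : AEStronglyMeasurable fun x : ℝ => ψ x / (-2 * Real.pi * Complex.I * x) :=
    (hψ.aestronglyMeasurable.aemeasurable.div hd.aemeasurable).aestronglyMeasurable
  have hψi : Integrable fun x : ℝ => min 1 |x| * ‖ψ x / (-2 * Real.pi * Complex.I * x)‖ := by
    refine hψ.norm.mono' (by fun_prop) (Eventually.of_forall fun x => ?_)
    rw [Real.norm_of_nonneg (by positivity), norm_div]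
    have e : ‖(-2 * Real.pi * Complex.I * x : ℂ)‖ = 2 * Real.pi * |x| := by
      simp [abs_of_pos Real.pi_pos]
    rw [e]
    rcases eq_or_ne x 0 with rfl | hx
    · simp
    · have hx' : 0 < |x| := abs_pos.2 hx
      calc min 1 |x| * (‖ψ x‖ / (2 * Real.pi * |x|)) ≤ |x| * (‖ψ x‖ / (2 * Real.pi * |x|)) := by
            gcongr; exact min_le_right _ _
        _ = ‖ψ x‖ / (2 * Real.pi) := by field_simp
        _ ≤ ‖ψ x‖ := div_le_self (norm_nonneg _) (by linarith [Real.pi_gt_three])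
  have hhi : Integrable fun x : ℝ => min 1 |x| * ‖h x‖ := by
    refine hh.norm.mono' (by fun_prop) (Eventually.of_forall fun x => ?_)
    rw [Real.norm_of_nonneg (by positivity)]
    exact mul_le_of_le_one_left (norm_nonneg _) (min_le_left _ _)
  have hnm : AEStronglyMeasurable n := hh.aestronglyMeasurable.add hψm
  have hni : Integrable fun x : ℝ => min 1 |x| * ‖n x‖ := by
    refine (hhi.add hψi).mono' (by fun_prop) (Eventually.of_forall fun x => ?_)
    rw [Real.norm_of_nonneg (by positivity), Pi.add_apply, ← mul_add]
    gcongr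
    exact norm_add_le _ _
  have hexp : ∀ z : ℝ, p + charFun η z = Complex.exp (c + ∫ x, h x)
      * Complex.exp (∫ x : ℝ, (Complex.exp (Complex.I * x * z) - 1) * n x) := by
    intro z
    rw [charFun_eq_fourier_rnDeriv hη, hF, ← Complex.exp_add, fourier_neg_two_pi_inv_mul,
      intervalIntegral_fourier_eq hψ]
    congr 1
    have e : ∫ x : ℝ, (Complex.exp (Complex.I * x * z) - 1) * n x
        = (∫ x : ℝ, Complex.exp (Complex.I * x * z) * h x) - (∫ x, h x)
        + ∫ x : ℝ, (Complex.exp (Complex.I * x * z) - 1)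
          * (ψ x / (-2 * Real.pi * Complex.I * x)) := by
      rw [← integral_sub (integrable_exp_mul hh z) hh,
        ← integral_add (f := fun x : ℝ => Complex.exp (Complex.I * x * z) * h x - h x)
          ((integrable_exp_mul hh z).sub hh) (integrable_exp_sub_one_mul hψm hψi z)]
      refine integral_congr_ae (Eventually.of_forall fun x => ?_)
      simp only [hn]
      ring
    rw [e]
    ring
  have h0 : (p : ℂ) + charFun η 0 = 1 := by
    rw [charFun_zero]; exact_mod_cast h1
  have hc : Complex.exp (c + ∫ x, h x) = 1 := by
    have := hexp 0
    rw [h0] at this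
    simpa using this.symm
  simp only [hc, one_mul] at hexp
  have hcont : Continuous (charFun η) := continuous_charFun
  have hre := eq_exp_integral_re (f := fun z => p + charFun η z) (by fun_prop) h0
    (fun z => by simp) hnm hni hexp
  have hnr : AEMeasurable fun x => (n x).re := Complex.measurable_re.comp_aemeasurable hnm.aemeasurable
  have hri : Integrable fun x : ℝ => min 1 |x| * |(n x).re| := by
    refine hni.mono' (by fun_prop) (Eventually.of_forall fun x => ?_)
    rw [Real.norm_of_nonneg (by positivity)]
    gcongr
    exact Complex.abs_re_le_norm _
  obtain ⟨γ, α, β, hα, hβ, hz⟩ := exists_isLevyType_integral_eq hnr hri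
  exact ⟨γ, α, β, hα, hβ, fun z => by rw [hre z, hz z]⟩

end

/-! ### Continuous convolution semigroups -/

/-- A weakly continuous convolution semigroup of probability measures on `ℝ`, described through
characteristic functions. -/
structure IsConvolutionSemigroup (κ : ℝ≥0 → Measure ℝ) : Prop where
  isProbabilityMeasure : ∀ t, IsProbabilityMeasure (κ t)
  charFun_at_zero : ∀ z, charFun (κ 0) z = 1
  charFun_add : ∀ s t z, charFun (κ (s + t)) z = charFun (κ s) z * charFun (κ t) z
  continuous_charFun_time : ∀ z, Continuous fun t => charFun (κ t) z

/-- A continuous multiplicative function on the half line is an exponential. -/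
theorem exists_eq_exp_mul_of_map_add {c : ℝ≥0 → ℂ} (hc : Continuous c) (h0 : c 0 = 1)
    (hadd : ∀ s t, c (s + t) = c s * c t) : ∃ a : ℂ, ∀ t : ℝ≥0, c t = Complex.exp (t * a) := by
  set C : ℝ → ℂ := fun x => c x.toNNReal with hCdef
  have hC : Continuous C := hc.comp continuous_real_toNNReal
  have hC0 : C 0 = 1 := by simp [hCdef, h0]
  have hCadd : ∀ x y : ℝ, 0 ≤ x → 0 ≤ y → C (x + y) = C x * C y := fun x y hx hy => by
    simp only [hCdef, Real.toNNReal_add hx hy, hadd]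
  set F : ℝ → ℂ := fun x => ∫ u in (0 : ℝ)..x, C u with hFdef
  have hF : ∀ x, HasDerivAt F (C x) x := fun x =>
    intervalIntegral.integral_hasDerivAt_right (hC.intervalIntegrable _ _)
      (hC.stronglyMeasurableAtFilter _ _) hC.continuousAt
  -- `F' 0 = 1`, so `F` does not vanish at small positive `s`
  obtain ⟨s, hs, hFs⟩ : ∃ s : ℝ, 0 < s ∧ F s ≠ 0 := by
    have h1 : ∀ᶠ x in 𝓝[≠] (0 : ℝ), F x ≠ 0 :=
      (hF 0).eventually_ne (c := 0) (by rw [hC0]; exact one_ne_zero)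
    have h2 : 𝓝[>] (0 : ℝ) ≤ 𝓝[≠] 0 := nhdsWithin_mono _ fun x (hx : 0 < x) => hx.ne'
    obtain ⟨s, hs1, hs2⟩ := ((h1.filter_mono h2).and self_mem_nhdsWithin).exists
    exact ⟨s, hs2, hs1⟩
  -- `C (x + u) = C x * C u` gives `C x = (F (x + s) - F x) / F s`, so `C` is differentiable
  set a : ℂ := (C s - 1) / F s with ha
  set R : ℝ → ℂ := fun x => (F (x + s) - F x) / F s with hRdef
  have hR : ∀ x, 0 ≤ x → R x = C x := fun x hx => by
    have e : F (x + s) - F x = C x * F s := by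
      have h1 : F (x + s) - F x = ∫ u in x..(x + s), C u :=
        intervalIntegral.integral_interval_sub_left (hC.intervalIntegrable _ _)
          (hC.intervalIntegrable _ _)
      have h2 : ∫ u in x..(x + s), C u = ∫ u in (0 : ℝ)..s, C (x + u) := by
        rw [intervalIntegral.integral_comp_add_left, add_zero]
      rw [h1, h2, hFdef]
      simp only
      rw [← intervalIntegral.integral_const_mul]
      refine intervalIntegral.integral_congr fun u hu => ?_
      rw [uIcc_of_le hs.le] at hu
      exact hCadd x u hx hu.1
    rw [hRdef]
    simp only
    rw [e, mul_div_cancel_right₀ _ hFs]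
  have hRd : ∀ x, 0 ≤ x → HasDerivAt R (a * R x) x := fun x hx => by
    have h1 : HasDerivAt (fun y => F (y + s)) (C (x + s)) x := (hF (x + s)).comp_add_const x s
    refine ((h1.sub (hF x)).div_const (F s)).congr_deriv ?_
    rw [hR x hx, hCadd x s hx hs.le, ha]
    ring
  have hconst : ∀ x : ℝ, 0 ≤ x → R x * Complex.exp (-(a * x)) = 1 := fun x hx => by
    have hd : ∀ y : ℝ, 0 ≤ y → HasDerivAt (fun y : ℝ => R y * Complex.exp (-(a * y))) 0 y := by
      intro y hy
      have h1 : HasDerivAt (fun y : ℝ => -(a * (y : ℂ))) (-(a * 1)) y :=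
        ((hasDerivAt_id y).ofReal_comp.const_mul a).neg
      refine ((hRd y hy).fun_mul h1.cexp).congr_deriv ?_
      ring
    have := constant_of_has_deriv_right_zero (a := 0) (b := x)
      (fun y hy => (hd y hy.1).continuousAt.continuousWithinAt)
      (fun y hy => (hd y hy.1).hasDerivWithinAt) x ⟨hx, le_rfl⟩
    rw [this, hR 0 le_rfl, hC0]
    simp
  refine ⟨a, fun t => ?_⟩
  have h1 := hconst t t.2
  rw [hR t t.2] at h1
  have h2 : C t = c t := by simp [hCdef]
  rw [h2, Complex.exp_neg] at h1
  have h3 := Complex.exp_ne_zero (a * ((t : ℝ) : ℂ))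
  rw [mul_inv_eq_one₀ h3] at h1
  rw [h1, mul_comm]

theorem norm_charFun_sub_one_le (μ : Measure ℝ) [IsProbabilityMeasure μ] (z : ℝ) :
    ‖charFun μ z - 1‖ ≤ (2 + |z|) * ∫ x, min 1 |x| ∂μ := by
  have hi : Integrable (fun x : ℝ => min 1 |x|) μ :=
    (integrable_const (1 : ℝ)).mono' (by fun_prop) (Eventually.of_forall fun x => by
      rw [Real.norm_of_nonneg (by positivity)]; exact min_le_left _ _)
  have hexp : Integrable (fun x : ℝ => Complex.exp (Complex.I * x * z)) μ :=
    (integrable_const (1 : ℝ)).mono' (by fun_prop) (Eventually.of_forall fun x => by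
      rw [mul_assoc, mul_comm, ← Complex.ofReal_mul, Complex.norm_exp_ofReal_mul_I])
  have e : charFun μ z - 1 = ∫ x : ℝ, (Complex.exp (Complex.I * x * z) - 1) ∂μ := by
    rw [integral_sub hexp (integrable_const _), charFun_apply_real]
    simp only [integral_const, probReal_univ, one_smul]
    congr 2 with x
    congr 1
    ring
  rw [e, ← integral_const_mul]
  exact norm_integral_le_of_norm_le (hi.const_mul _)
    (Eventually.of_forall fun x => norm_exp_I_mul_sub_one_le_min x z)

namespace IsConvolutionSemigroup

variable {κ : ℝ≥0 → Measure ℝ}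

/-- The member `κ t` of the semigroup as a point of the space of probability measures with the
weak topology. -/
def toProbabilityMeasure (hκ : IsConvolutionSemigroup κ) (t : ℝ≥0) : ProbabilityMeasure ℝ :=
  ⟨κ t, hκ.isProbabilityMeasure t⟩

theorem continuous_toProbabilityMeasure (hκ : IsConvolutionSemigroup κ) :
    Continuous hκ.toProbabilityMeasure := by
  refine continuous_iff_seqContinuous.2 fun x t hx => ?_
  rw [ProbabilityMeasure.tendsto_iff_tendsto_charFun]
  exact fun z => ((hκ.continuous_charFun_time z).tendsto t).comp hx

theorem measurable (hκ : IsConvolutionSemigroup κ) : Measurable κ := by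
  have hprob := hκ.isProbabilityMeasure
  refine Measurable.measure_of_isPiSystem_of_isProbabilityMeasure
    (S := {F : Set ℝ | IsClosed F})
    (BorelSpace.measurable_eq.trans borel_eq_generateFrom_isClosed)
    isPiSystem_isClosed fun F hF => ?_
  have hF' : IsClosed F := hF
  refine measurable_of_tendsto_metrizable (f := fun n t => ∫⁻ x, hF'.apprSeq n x ∂(κ t))
    (fun n => Continuous.measurable ?_)
    (tendsto_pi_nhds.2 fun t => HasOuterApproxClosed.tendsto_lintegral_apprSeq hF' (κ t))
  refine continuous_iff_continuousAt.2 fun t => ?_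
  exact (ProbabilityMeasure.tendsto_iff_forall_lintegral_tendsto.1
    (hκ.continuous_toProbabilityMeasure.tendsto t)) (hF'.apprSeq n)

theorem tendsto_integral_min_one_abs (hκ : IsConvolutionSemigroup κ) :
    Tendsto (fun t => ∫ x, min 1 |x| ∂(κ t)) (𝓝 0) (𝓝 0) := by
  have hprob := hκ.isProbabilityMeasure
  have h0 : κ 0 = Measure.dirac 0 := by
    refine Measure.ext_of_charFun ?_
    ext z
    rw [hκ.charFun_at_zero, charFun_dirac]
    simp
  let f : BoundedContinuousFunction ℝ ℝ :=
    BoundedContinuousFunction.ofNormedAddCommGroup (fun x : ℝ => min 1 |x|) (by fun_prop) 1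
      fun x => by rw [Real.norm_of_nonneg (by positivity)]; exact min_le_left _ _
  have h := (ProbabilityMeasure.tendsto_iff_forall_integral_tendsto.1
    (hκ.continuous_toProbabilityMeasure.tendsto 0)) f
  have e : ∫ x, f x ∂(κ 0) = 0 := by
    rw [h0, integral_dirac]
    simp [f]
  have h' : Tendsto (fun t => ∫ x, f x ∂(κ t)) (𝓝 0) (𝓝 (∫ x, f x ∂(κ 0))) := h
  rw [e] at h'
  exact h'

/-- The characteristic exponent: `charFun (κ t) = exp (t ψ)` with `ψ` continuous. -/
theorem exists_exponent (hκ : IsConvolutionSemigroup κ) : ∃ ψ : ℝ → ℂ, Continuous ψ ∧ ψ 0 = 0 ∧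
    ∀ (t : ℝ≥0) z, charFun (κ t) z = Complex.exp (t * ψ z) := by
  have hprob := hκ.isProbabilityMeasure
  choose ψ hψ using fun z => exists_eq_exp_mul_of_map_add (hκ.continuous_charFun_time z)
    (hκ.charFun_at_zero z) fun s t => hκ.charFun_add s t z
  have hψr : ∀ (u : ℝ) z, 0 ≤ u → charFun (κ u.toNNReal) z = Complex.exp (ψ z * u) := by
    intro u z hu
    rw [hψ, Real.coe_toNNReal u hu, mul_comm]
  -- `ψ(z) ∫₀ˢ exp(u ψ(z)) du = exp(s ψ(z)) - 1`, with a non-vanishing integral for small `s`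
  have key : ∀ s : ℝ, 0 ≤ s → ContinuousOn ψ
      {z | ∫ u in (0 : ℝ)..s, charFun (κ u.toNNReal) z ≠ 0} := by
    intro s hs
    have hJ : Continuous fun z => ∫ u in (0 : ℝ)..s, charFun (κ u.toNNReal) z := by
      refine intervalIntegral.continuous_of_dominated_interval (bound := fun _ => 1) (fun z => ?_)
        (fun z => Eventually.of_forall fun u _ => norm_charFun_le_one z)
        intervalIntegrable_const (Eventually.of_forall fun u _ => MeasureTheory.continuous_charFun)
      exact ((hκ.continuous_charFun_time z).comp continuous_real_toNNReal).aestronglyMeasurable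
    have hcs : Continuous fun z => charFun (κ s.toNNReal) z - 1 :=
      MeasureTheory.continuous_charFun.sub continuous_const
    refine (hcs.continuousOn.div hJ.continuousOn fun z hz => hz).congr fun z hz => ?_
    rw [Pi.div_apply, eq_div_iff hz, hψr s z hs]
    have e : ∫ u in (0 : ℝ)..s, charFun (κ u.toNNReal) z
        = ∫ u in (0 : ℝ)..s, Complex.exp (ψ z * u) :=
      intervalIntegral.integral_congr fun u hu => hψr u z (by
        rw [uIcc_of_le hs] at hu; exact hu.1)
    rw [e]
    rcases eq_or_ne (ψ z) 0 with h | h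
    · simp [h]
    · rw [integral_exp_mul_complex h, mul_div_cancel₀ _ h]
      simp
  have hψc : Continuous ψ := by
    refine continuous_iff_continuousAt.2 fun z₀ => ?_
    set Z := |z₀| + 1 with hZ
    have hZ0 : 0 < 2 + Z := by positivity
    have hsmall : ∀ᶠ t in 𝓝 (0 : ℝ≥0), ∫ x, min 1 |x| ∂(κ t) < 1 / (2 * (2 + Z)) :=
      hκ.tendsto_integral_min_one_abs.eventually_lt_const (by positivity)
    obtain ⟨δ, hδ, hδs⟩ := Metric.eventually_nhds_iff.1 hsmall
    set s := δ / 2 with hs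
    have hs0 : 0 < s := by positivity
    have hne : ∀ z, |z| < Z → ∫ u in (0 : ℝ)..s, charFun (κ u.toNNReal) z ≠ 0 := by
      intro z hz h
      have hb : ∀ u ∈ uIoc (0 : ℝ) s, ‖charFun (κ u.toNNReal) z - 1‖ ≤ 1 / 2 := by
        intro u hu
        rw [uIoc_of_le hs0.le] at hu
        have h1 : dist u.toNNReal 0 < δ := by
          rw [NNReal.dist_eq, Real.coe_toNNReal u hu.1.le, NNReal.coe_zero, sub_zero,
            abs_of_pos hu.1]
          linarith [hu.2]
        have h2 := hδs h1
        have h3 : 0 ≤ ∫ x, min 1 |x| ∂(κ u.toNNReal) := integral_nonneg fun x => by positivity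
        calc _ ≤ (2 + |z|) * ∫ x, min 1 |x| ∂(κ u.toNNReal) := norm_charFun_sub_one_le _ z
          _ ≤ (2 + Z) * (1 / (2 * (2 + Z))) := by gcongr
          _ = 1 / 2 := by field_simp
      have h4 := intervalIntegral.norm_integral_le_of_norm_le_const hb
      have hc : Continuous fun u : ℝ => charFun (κ u.toNNReal) z :=
        (hκ.continuous_charFun_time z).comp continuous_real_toNNReal
      rw [intervalIntegral.integral_sub (hc.intervalIntegrable _ _) intervalIntegrable_const,
        h, intervalIntegral.integral_const, zero_sub, norm_neg,
        sub_zero, norm_smul, norm_one, Real.norm_of_nonneg hs0.le, abs_of_pos hs0] at h4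
      linarith
    have hcont := key s hs0.le
    refine hcont.continuousAt ?_
    have : ∀ᶠ z in 𝓝 z₀, |z| < Z :=
      (continuous_abs.tendsto z₀).eventually_lt_const (by rw [hZ]; linarith)
    filter_upwards [this] with z hz using hne z hz
  refine ⟨ψ, hψc, ?_, fun t z => hψ z t⟩
  -- `exp (t ψ(0)) = 1` for all `t`, so `t ψ(0) ∈ 2πi ℤ`; this fails for `t = 1 / ‖ψ(0)‖`
  have h1 : ∀ t : ℝ≥0, Complex.exp (t * ψ 0) = 1 := fun t => by rw [← hψ]; simp
  by_contra hne
  set r : ℝ≥0 := ‖ψ 0‖₊⁻¹ with hr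
  have hn : ‖(r : ℂ) * ψ 0‖ = 1 := by
    rw [norm_mul]
    have : ‖((r : ℝ) : ℂ)‖ = ‖ψ 0‖⁻¹ := by
      rw [Complex.norm_real, hr, NNReal.coe_inv, coe_nnnorm, norm_inv, norm_norm]
    rw [this, inv_mul_cancel₀ (norm_ne_zero_iff.2 hne)]
  obtain ⟨k, hk⟩ := Complex.exp_eq_one_iff.1 (h1 r)
  rw [hk] at hn
  have h5 : ‖(k : ℂ) * (2 * Real.pi * Complex.I)‖ = |(k : ℝ)| * (2 * Real.pi) := by
    rw [norm_mul]
    simp [abs_of_pos Real.pi_pos]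
  rw [h5] at hn
  have h6 : k ≠ 0 := by rintro rfl; simp at hn
  have h7 : (1 : ℝ) ≤ |(k : ℝ)| := by exact_mod_cast Int.one_le_abs h6
  nlinarith [Real.pi_gt_three]

end IsConvolutionSemigroup

/-! ### The Lévy–Khintchine formula -/

/-- The weight `1 - sin x / x`, comparable to `1 ∧ x²`. -/
def sincWeight (x : ℝ) : ℝ := 1 - Real.sinc x

theorem continuous_sincWeight : Continuous sincWeight := continuous_const.sub Real.continuous_sinc

theorem sincWeight_zero : sincWeight 0 = 0 := by simp [sincWeight]

theorem sincWeight_nonneg (x : ℝ) : 0 ≤ sincWeight x := sub_nonneg.2 (Real.sinc_le_one x)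

theorem sincWeight_le_two (x : ℝ) : sincWeight x ≤ 2 := by
  have := Real.neg_one_le_sinc x
  unfold sincWeight; linarith

theorem sincWeight_neg (x : ℝ) : sincWeight (-x) = sincWeight x := by simp [sincWeight]

theorem abs_sincWeight_sub_le {x : ℝ} (hx : |x| ≤ 1) :
    |sincWeight x - x ^ 2 / 6| ≤ |x| ^ 4 / 100 := by
  rcases eq_or_ne x 0 with rfl | h0
  · simp [sincWeight]
  have hx0 : 0 < |x| := abs_pos.2 h0
  have e : sincWeight x - x ^ 2 / 6 = -((Real.sin x - (x - x ^ 3 / 6)) / x) := by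
    rw [sincWeight, Real.sinc_of_ne_zero h0]; field_simp; ring
  rw [e, abs_neg, abs_div, div_le_iff₀ hx0]
  refine (Real.sin_bound hx).trans (le_of_eq ?_)
  ring

theorem min_le_sincWeight (x : ℝ) : min 1 (x ^ 2) / 10 ≤ sincWeight x := by
  wlog hx : 0 ≤ x generalizing x
  · have := this (-x) (by linarith)
    rwa [sincWeight_neg, neg_sq] at this
  rcases le_total x 1 with h1 | h1
  · have h2 := abs_sincWeight_sub_le (x := x) (by rw [abs_of_nonneg hx]; exact h1)
    rw [abs_of_nonneg hx] at h2
    have h3 := (abs_le.1 h2).1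
    have h4 : x ^ 2 ≤ 1 := by nlinarith
    rw [min_eq_right h4]
    nlinarith [sq_nonneg x]
  · rw [min_eq_left (by nlinarith : (1 : ℝ) ≤ x ^ 2)]
    have hx0 : 0 < x := by linarith
    rw [sincWeight, Real.sinc_of_ne_zero hx0.ne']
    have h2 : Real.sin x ≤ 9 / 10 * x := by
      rcases le_total x (10 / 9) with h | h
      · have h3 := Real.sin_bound (x := 1) (by simp)
        have h4 := (abs_le.1 h3).2
        have h5 : |Real.sin x - Real.sin 1| ≤ |x - 1| := by
          simpa [Real.dist_eq] using Real.lipschitzWith_sin.dist_le_mul x 1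
        have h6 := (abs_le.1 h5).2
        rw [abs_of_nonneg (by linarith)] at h6
        norm_num at h4
        linarith
      · have := Real.sin_le_one x; linarith
    have h3 : Real.sin x / x ≤ 9 / 10 := by rwa [div_le_iff₀ hx0]
    linarith

theorem sincWeight_pos {x : ℝ} (hx : x ≠ 0) : 0 < sincWeight x :=
  lt_of_lt_of_le (by positivity) (min_le_sincWeight x)

/-- The variant `e^{ixz} - 1 - iz sin x` of the Lévy–Khintchine integrand. -/
def sinKernel (z x : ℝ) : ℂ := Complex.exp (Complex.I * x * z) - 1 - Complex.I * z * Real.sin x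

theorem continuous_sinKernel (z : ℝ) : Continuous (sinKernel z) := by
  unfold sinKernel; fun_prop

theorem sinKernel_sub_lkKernel (z x : ℝ) : sinKernel z x - lkKernel z x
    = Complex.I * z * ((Icc (-1 : ℝ) 1).indicator id x - Real.sin x : ℝ) := by
  unfold sinKernel lkKernel
  by_cases hx : x ∈ Icc (-1 : ℝ) 1
  · simp only [indicator_of_mem hx, id]; push_cast; ring
  · simp only [indicator_of_notMem hx]; push_cast; ring

theorem abs_sub_sin_le {x : ℝ} (hx : |x| ≤ 1) : |x - Real.sin x| ≤ |x| ^ 3 := by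
  have h1 := Real.sin_bound hx
  have h2 : x - Real.sin x = -(Real.sin x - (x - x ^ 3 / 6)) + x ^ 3 / 6 := by ring
  rw [h2]
  refine (abs_add_le _ _).trans ?_
  rw [abs_neg, abs_div, abs_pow, abs_of_pos (by norm_num : (0 : ℝ) < 6)]
  have h3 : |x| ^ 5 ≤ |x| ^ 3 := pow_le_pow_of_le_one (abs_nonneg _) hx (by norm_num)
  have h4 : 0 ≤ |x| ^ 3 := by positivity
  linarith

theorem abs_indicator_sub_sin_le (x : ℝ) :
    |(Icc (-1 : ℝ) 1).indicator id x - Real.sin x| ≤ min 1 (x ^ 2) := by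
  by_cases hx : x ∈ Icc (-1 : ℝ) 1
  · have h1 : |x| ≤ 1 := abs_le.2 hx
    have h2 : x ^ 2 ≤ 1 := by nlinarith [hx.1, hx.2]
    rw [indicator_of_mem hx, min_eq_right h2, ← sq_abs]
    exact (abs_sub_sin_le h1).trans (pow_le_pow_of_le_one (abs_nonneg _) h1 (by norm_num))
  · have h1 : 1 ≤ x ^ 2 := by
      rw [mem_Icc, ← abs_le, not_le] at hx
      rw [← sq_abs]; nlinarith
    rw [indicator_of_notMem hx, min_eq_left h1, zero_sub, abs_neg]
    exact Real.abs_sin_le_one x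

theorem norm_sinKernel_le (z x : ℝ) :
    ‖sinKernel z x‖ ≤ (2 + 3 * z ^ 2 + |z|) * min 1 (x ^ 2) := by
  have h := norm_lkKernel_le z x
  have h2 : ‖sinKernel z x - lkKernel z x‖ ≤ |z| * min 1 (x ^ 2) := by
    rw [sinKernel_sub_lkKernel, norm_mul, norm_mul, Complex.norm_I, one_mul, Complex.norm_real,
      Complex.norm_real, Real.norm_eq_abs, Real.norm_eq_abs]
    gcongr
    exact abs_indicator_sub_sin_le x
  have h3 : sinKernel z x = (sinKernel z x - lkKernel z x) + lkKernel z x := by ring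
  rw [h3]
  refine (norm_add_le _ _).trans ?_
  linarith

theorem norm_sinKernel_add_le (z : ℝ) {x : ℝ} (hx : |x| ≤ 1) :
    ‖sinKernel z x + 3 * z ^ 2 * sincWeight x‖
      ≤ (|z| ^ 3 * Real.exp |z| + |z| + 3 * z ^ 2) * |x| ^ 3 := by
  set w : ℂ := Complex.I * x * z with hw
  have hwn : ‖w‖ = |x| * |z| := by simp [hw]
  have h1 := Complex.norm_exp_sub_sum_le_norm_mul_exp w 3
  have h2 : ‖w‖ ^ 3 * Real.exp ‖w‖ ≤ |z| ^ 3 * Real.exp |z| * |x| ^ 3 := by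
    rw [hwn]
    have : |x| * |z| ≤ |z| := mul_le_of_le_one_left (abs_nonneg _) hx
    calc (|x| * |z|) ^ 3 * Real.exp (|x| * |z|) ≤ (|x| * |z|) ^ 3 * Real.exp |z| := by gcongr
      _ = _ := by ring
  have h3 : ‖Complex.I * z * ((x - Real.sin x : ℝ) : ℂ)‖ ≤ |z| * |x| ^ 3 := by
    rw [norm_mul, norm_mul, Complex.norm_I, one_mul, Complex.norm_real, Complex.norm_real,
      Real.norm_eq_abs, Real.norm_eq_abs]
    gcongr
    exact abs_sub_sin_le hx
  have h4 : ‖3 * (z : ℂ) ^ 2 * ((sincWeight x - x ^ 2 / 6 : ℝ) : ℂ)‖ ≤ 3 * z ^ 2 * |x| ^ 3 := by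
    rw [norm_mul, norm_mul, norm_pow, Complex.norm_real, Complex.norm_real, Real.norm_eq_abs,
      Real.norm_eq_abs, sq_abs, Complex.norm_ofNat]
    have h5 := abs_sincWeight_sub_le hx
    have h6 : |x| ^ 4 ≤ |x| ^ 3 := pow_le_pow_of_le_one (abs_nonneg _) hx (by norm_num)
    have h7 : 0 ≤ |x| ^ 3 := by positivity
    gcongr
    linarith
  have e : sinKernel z x + 3 * z ^ 2 * sincWeight x
      = (Complex.exp w - ∑ m ∈ Finset.range 3, w ^ m / (m.factorial : ℂ))
        + Complex.I * z * ((x - Real.sin x : ℝ) : ℂ)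
        + 3 * (z : ℂ) ^ 2 * ((sincWeight x - x ^ 2 / 6 : ℝ) : ℂ) := by
    rw [sinKernel, hw]
    simp only [Finset.sum_range_succ, Finset.sum_range_zero, Nat.factorial]
    push_cast
    ring_nf
    rw [Complex.I_sq]
    ring
  rw [e]
  refine (norm_add₃_le).trans ?_
  linarith

/-- The quotient of the integrand `e^{ixz} - 1 - iz sin x` by the weight `1 - sin x / x`, extended
continuously to `x = 0`. -/
def ratioKernel (z x : ℝ) : ℂ := if x = 0 then -3 * (z : ℂ) ^ 2 else sinKernel z x / sincWeight x

theorem ratioKernel_mul (z x : ℝ) : ratioKernel z x * sincWeight x = sinKernel z x := by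
  unfold ratioKernel
  split_ifs with h
  · subst h; simp [sincWeight_zero, sinKernel]
  · exact div_mul_cancel₀ _ (by exact_mod_cast (sincWeight_pos h).ne')

theorem norm_ratioKernel_le (z x : ℝ) : ‖ratioKernel z x‖ ≤ 10 * (2 + 3 * z ^ 2 + |z|) := by
  unfold ratioKernel
  split_ifs with h
  · rw [norm_mul, norm_neg, Complex.norm_ofNat, norm_pow, Complex.norm_real, Real.norm_eq_abs,
      sq_abs]
    have := abs_nonneg z
    nlinarith [sq_nonneg z]
  · have h1 := sincWeight_pos h
    rw [norm_div, Complex.norm_real, Real.norm_of_nonneg h1.le, div_le_iff₀ h1]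
    refine (norm_sinKernel_le z x).trans ?_
    have h2 := min_le_sincWeight x
    have h3 : 0 ≤ 2 + 3 * z ^ 2 + |z| := by positivity
    nlinarith [mul_le_mul_of_nonneg_left h2 h3]

theorem continuous_ratioKernel (z : ℝ) : Continuous (ratioKernel z) := by
  refine continuous_iff_continuousAt.2 fun x => ?_
  rcases eq_or_ne x 0 with rfl | hx
  · set C := 10 * (|z| ^ 3 * Real.exp |z| + |z| + 3 * z ^ 2) with hC
    have hlim : Tendsto (fun x : ℝ => C * |x|) (𝓝 0) (𝓝 0) := by
      have : Continuous fun x : ℝ => C * |x| := by fun_prop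
      simpa using this.tendsto 0
    rw [ContinuousAt, tendsto_iff_norm_sub_tendsto_zero]
    have hev : ∀ᶠ x : ℝ in 𝓝 0, |x| < 1 := by
      have := (continuous_abs (G := ℝ)).tendsto 0
      rw [abs_zero] at this
      exact this.eventually_lt_const one_pos
    refine squeeze_zero' (Eventually.of_forall fun x => norm_nonneg _) ?_ hlim
    filter_upwards [hev] with x hx
    rcases eq_or_ne x 0 with rfl | h0
    · simp
    have hpos := sincWeight_pos h0
    have hpos' : (sincWeight x : ℂ) ≠ 0 := by exact_mod_cast hpos.ne'
    have e : ratioKernel z x - ratioKernel z 0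
        = (sinKernel z x + 3 * z ^ 2 * sincWeight x) / sincWeight x := by
      simp only [ratioKernel, h0, if_true, if_false]
      field_simp
      ring
    rw [e, norm_div, Complex.norm_real, Real.norm_of_nonneg hpos.le, div_le_iff₀ hpos]
    refine (norm_sinKernel_add_le z hx.le).trans ?_
    have h1 := min_le_sincWeight x
    have h2 : x ^ 2 ≤ 1 := by rw [← sq_abs]; nlinarith [abs_nonneg x]
    rw [min_eq_right h2, ← sq_abs] at h1
    have h3 : 0 ≤ (|z| ^ 3 * Real.exp |z| + |z| + 3 * z ^ 2) * |x| := by positivity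
    calc _ = (|z| ^ 3 * Real.exp |z| + |z| + 3 * z ^ 2) * |x| * |x| ^ 2 := by ring
      _ ≤ (|z| ^ 3 * Real.exp |z| + |z| + 3 * z ^ 2) * |x| * (10 * sincWeight x) := by
          gcongr; linarith
      _ = C * |x| * sincWeight x := by rw [hC]; ring
  · have h1 : ContinuousAt (fun x => sinKernel z x / sincWeight x) x :=
      (continuous_sinKernel z).continuousAt.div
        (Complex.continuous_ofReal.comp continuous_sincWeight).continuousAt
        (by exact_mod_cast (sincWeight_pos hx).ne')
    refine h1.congr ?_
    filter_upwards [isOpen_ne.mem_nhds hx] with y hy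
    simp only [ratioKernel, if_neg hy]

/-- Multiplying a measure by `1 - sin x / x` amounts to subtracting from the characteristic function
its mean over the interval of radius `1`. -/
theorem charFun_withDensity_sincWeight (μ : Measure ℝ) [IsProbabilityMeasure μ] (z : ℝ) :
    charFun (μ.withDensity fun x => ENNReal.ofReal (sincWeight x)) z
      = charFun μ z - (1 / 2) * ∫ u in (-1 : ℝ)..1, charFun μ (z + u) := by
  have hm : AEMeasurable (fun x => ENNReal.ofReal (sincWeight x)) μ :=
    (ENNReal.continuous_ofReal.comp continuous_sincWeight).aemeasurable
  have hexp : ∀ y x : ℝ, ‖Complex.exp (y * x * Complex.I)‖ = 1 := fun y x => by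
    rw [← Complex.ofReal_mul, Complex.norm_exp_ofReal_mul_I]
  have hswap : ∫ u in (-1 : ℝ)..1, charFun μ (z + u)
      = ∫ x, 2 * (Complex.exp (z * x * Complex.I) * Real.sinc x) ∂μ := by
    simp_rw [charFun_apply_real]
    rw [intervalIntegral_integral_swap]
    · refine integral_congr_ae (Eventually.of_forall fun x => ?_)
      have h1 : ∀ u : ℝ, Complex.exp (((z + u : ℝ) : ℂ) * x * Complex.I)
          = Complex.exp (z * x * Complex.I) * Complex.exp (Complex.I * x * u) := fun u => by
        rw [← Complex.exp_add]; push_cast; ring_nf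
      simp only [h1, intervalIntegral.integral_const_mul]
      rw [mul_left_comm]
      congr 1
      rcases eq_or_ne x 0 with rfl | hx
      · simp; norm_num
      · have hx' : (x : ℂ) ≠ 0 := by exact_mod_cast hx
        have hc : Complex.I * (x : ℂ) ≠ 0 := mul_ne_zero Complex.I_ne_zero hx'
        rw [integral_exp_mul_complex hc, Real.sinc_of_ne_zero hx]
        push_cast
        rw [Complex.sin]
        have := Complex.I_ne_zero
        field_simp
        rw [Complex.I_sq]
        ring_nf
    · have : IsFiniteMeasure (volume.restrict (uIoc (-1 : ℝ) 1)) :=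
        ⟨by rw [Measure.restrict_apply_univ]; exact measure_Ioc_lt_top⟩
      refine (integrable_const (1 : ℝ)).mono' (by fun_prop) (Eventually.of_forall fun q => ?_)
      exact (hexp _ _).le
  have hi1 : Integrable (fun x : ℝ => Complex.exp (z * x * Complex.I)) μ :=
    (integrable_const (1 : ℝ)).mono' (by fun_prop) (Eventually.of_forall fun x => (hexp z x).le)
  have hi2 : Integrable (fun x : ℝ => Complex.exp (z * x * Complex.I) * Real.sinc x) μ := by
    refine hi1.mul_bdd (c := 1)
      (Complex.continuous_ofReal.comp Real.continuous_sinc).aestronglyMeasurable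
      (Eventually.of_forall fun x => ?_)
    rw [Complex.norm_real]; exact Real.abs_sinc_le_one x
  rw [hswap, integral_const_mul, ← mul_assoc, one_div, inv_mul_cancel₀ two_ne_zero, one_mul,
    charFun_apply_real, charFun_apply_real, ← integral_sub hi1 hi2,
    integral_withDensity_eq_integral_toReal_smul₀ hm
      (Eventually.of_forall fun x => ENNReal.ofReal_lt_top)]
  refine integral_congr_ae (Eventually.of_forall fun x => ?_)
  simp only [ENNReal.toReal_ofReal (sincWeight_nonneg x), Complex.real_smul]
  rw [sincWeight]
  push_cast
  ring

/-- If the characteristic functions of finite measures of mass at least `1` converge to a function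
that is continuous at `0`, then the measures have a weak limit point. -/
theorem exists_tendsto_integral_of_tendsto_charFun {m : ℕ → Measure ℝ} [∀ n, IsFiniteMeasure (m n)]
    (hm : ∀ n, 1 ≤ (m n).real univ) {Γ : ℝ → ℂ} (hΓ : ContinuousAt Γ 0)
    (h : ∀ z, Tendsto (fun n => charFun (m n) z) atTop (𝓝 (Γ z))) :
    ∃ G : Measure ℝ, IsFiniteMeasure G ∧ ∀ f : BoundedContinuousFunction ℝ ℂ,
      Tendsto (fun n => ∫ x, f x ∂(m n)) (hyperfilter ℕ) (𝓝 (∫ x, f x ∂G)) := by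
  set a : ℕ → ℝ := fun n => (m n).real univ with ha
  have ha0 : Tendsto (fun n => (a n : ℂ)) atTop (𝓝 (Γ 0)) := by
    simpa only [charFun_zero] using h 0
  have har : Tendsto a atTop (𝓝 (Γ 0).re) := by
    exact (Complex.continuous_re.tendsto _).comp ha0
  have hA : 1 ≤ (Γ 0).re := ge_of_tendsto' har hm
  have hA0 : (0 : ℝ) < (Γ 0).re := by linarith
  have hne : ∀ n, NeZero (m n) := fun n => ⟨fun h0 => by
    have := hm n
    rw [h0] at this
    norm_num at this⟩
  set H : ℕ → Measure ℝ := fun n => ((m n) univ)⁻¹ • m n with hH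
  have hHp : ∀ n, IsProbabilityMeasure (H n) := fun n => isProbabilityMeasureSMul
  have hHint : ∀ n (f : ℝ → ℂ), ∫ x, f x ∂(H n) = (a n : ℂ)⁻¹ * ∫ x, f x ∂(m n) := fun n f => by
    rw [hH, integral_smul_measure, ENNReal.toReal_inv]
    simp [ha, measureReal_def]
  have haC : (Γ 0) = ((Γ 0).re : ℂ) := by
    refine tendsto_nhds_unique ha0 ?_
    exact (Complex.continuous_ofReal.tendsto _).comp har
  have hlim : ∀ z, Tendsto (fun n => charFun (H n) z) atTop (𝓝 ((Γ 0)⁻¹ * Γ z)) := fun z => by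
    have h0 : Γ 0 ≠ 0 := by rw [haC]; exact_mod_cast hA0.ne'
    refine ((ha0.inv₀ h0).mul (h z)).congr fun n => ?_
    rw [charFun_apply, charFun_apply, hHint]
  have htight := isTightMeasureSet_of_tendsto_charFun (f := fun z => (Γ 0)⁻¹ * Γ z)
    (continuousAt_const.mul hΓ) hlim
  set HP : ℕ → ProbabilityMeasure ℝ := fun n => ⟨H n, hHp n⟩ with hHP
  have hcomp : IsCompact (closure (range HP)) := by
    refine isCompact_closure_of_isTightMeasureSet ?_
    convert htight using 1
    ext μ
    constructor
    · rintro ⟨_, ⟨n, rfl⟩, rfl⟩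
      exact ⟨n, rfl⟩
    · rintro ⟨n, rfl⟩
      exact ⟨_, ⟨n, rfl⟩, rfl⟩
  obtain ⟨H₀, -, hH₀⟩ := hcomp.ultrafilter_le_nhds ((hyperfilter ℕ).map HP)
    (le_principal_iff.2 (mem_map.2 (Eventually.of_forall fun n => subset_closure (mem_range_self n))))
  have hH₀' : Tendsto HP (hyperfilter ℕ) (𝓝 H₀) := hH₀
  refine ⟨ENNReal.ofReal (Γ 0).re • (H₀ : Measure ℝ), ?_, fun f => ?_⟩
  · exact Measure.smul_finite _ ENNReal.ofReal_ne_top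
  · have h1 := (ProbabilityMeasure.tendsto_iff_forall_integral_rclike_tendsto ℂ).1 hH₀' f
    have h2 := (ha0.mono_left Nat.hyperfilter_le_atTop).mul h1
    rw [integral_smul_measure, ENNReal.toReal_ofReal hA0.le, Complex.real_smul, ← haC]
    refine h2.congr fun n => ?_
    have h3 : ∫ x, f x ∂(HP n : Measure ℝ) = ∫ x, f x ∂(H n) := rfl
    have h4 : (a n : ℂ) ≠ 0 := by
      have := hm n
      exact_mod_cast (by linarith : (0 : ℝ) < a n).ne'
    rw [h3, hHint, mul_inv_cancel_left₀ h4]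

theorem norm_nat_mul_exp_div_sub_one_le (w : ℂ) (n : ℕ) :
    ‖((n : ℂ) + 1) * (Complex.exp (((n : ℂ) + 1)⁻¹ * w) - 1)‖ ≤ ‖w‖ * Real.exp ‖w‖ := by
  have hn : ‖(n : ℂ) + 1‖ = (n : ℝ) + 1 := by
    rw [← Nat.cast_succ, Complex.norm_natCast]; simp
  have hn1 : (1 : ℝ) ≤ (n : ℝ) + 1 := by simp
  set v := ((n : ℂ) + 1)⁻¹ * w with hv
  have hvn : ‖v‖ = ((n : ℝ) + 1)⁻¹ * ‖w‖ := by rw [hv, norm_mul, norm_inv, hn]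
  have hvw : ‖v‖ ≤ ‖w‖ := by
    rw [hvn]; exact mul_le_of_le_one_left (norm_nonneg _) (inv_le_one_of_one_le₀ hn1)
  have h := Complex.norm_exp_sub_sum_le_norm_mul_exp v 1
  simp only [Finset.sum_range_one, pow_zero, Nat.factorial_zero, Nat.cast_one, div_one,
    pow_one] at h
  rw [norm_mul, hn]
  calc ((n : ℝ) + 1) * ‖Complex.exp v - 1‖ ≤ ((n : ℝ) + 1) * (‖v‖ * Real.exp ‖w‖) := by
        gcongr
        exact h.trans (by gcongr)
    _ = ‖w‖ * Real.exp ‖w‖ := by rw [hvn]; field_simp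

theorem tendsto_nat_mul_exp_div_sub_one (w : ℂ) :
    Tendsto (fun n : ℕ => ((n : ℂ) + 1) * (Complex.exp (((n : ℂ) + 1)⁻¹ * w) - 1)) atTop (𝓝 w) := by
  rw [tendsto_iff_norm_sub_tendsto_zero]
  have hlim : Tendsto (fun n : ℕ => 1 / ((n : ℝ) + 1) * (‖w‖ ^ 2 * Real.exp ‖w‖)) atTop (𝓝 0) := by
    simpa using tendsto_one_div_add_atTop_nhds_zero_nat.mul_const (‖w‖ ^ 2 * Real.exp ‖w‖)
  refine squeeze_zero (fun n => norm_nonneg _) (fun n => ?_) hlim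
  have hn : ‖(n : ℂ) + 1‖ = (n : ℝ) + 1 := by
    rw [← Nat.cast_succ, Complex.norm_natCast]; simp
  have hn0 : (n : ℂ) + 1 ≠ 0 := by exact_mod_cast Nat.succ_ne_zero n
  have hn1 : (1 : ℝ) ≤ (n : ℝ) + 1 := by simp
  set v := ((n : ℂ) + 1)⁻¹ * w with hv
  have hvn : ‖v‖ = ((n : ℝ) + 1)⁻¹ * ‖w‖ := by rw [hv, norm_mul, norm_inv, hn]
  have hvw : ‖v‖ ≤ ‖w‖ := by
    rw [hvn]; exact mul_le_of_le_one_left (norm_nonneg _) (inv_le_one_of_one_le₀ hn1)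
  have h := Complex.norm_exp_sub_sum_le_norm_mul_exp v 2
  simp only [Finset.sum_range_succ, Finset.sum_range_zero, Nat.factorial, pow_zero, pow_one] at h
  have e : ((n : ℂ) + 1) * (Complex.exp v - 1) - w
      = ((n : ℂ) + 1) * (Complex.exp v - (0 + 1 / ((1 : ℕ) : ℂ) + v / ((0 + 1) * 1 : ℕ))) := by
    have : ((n : ℂ) + 1) * v = w := by rw [hv, mul_inv_cancel_left₀ hn0]
    push_cast
    rw [div_one, div_one]
    linear_combination this
  rw [e, norm_mul, hn]
  calc ((n : ℝ) + 1) * _ ≤ ((n : ℝ) + 1) * (‖v‖ ^ 2 * Real.exp ‖w‖) := by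
        gcongr
        exact h.trans (by gcongr)
    _ = 1 / ((n : ℝ) + 1) * (‖w‖ ^ 2 * Real.exp ‖w‖) := by rw [hvn]; field_simp

/-- The representation of an exponent through a finite measure `G` and the kernel `ratioKernel`
turns into a Lévy–Khintchine representation with the Lévy-type measure of density
`1 / (1 - sin x / x)` with respect to `G` away from `0`; the mass of `G` at `0` contributes to the
Gaussian part. -/
theorem exists_lkKernel_of_ratioKernel {G : Measure ℝ} [IsFiniteMeasure G] :
    ∃ (a γ : ℝ) (ν : Measure ℝ), IsLevyType ν ∧ ∀ z : ℝ, ∫ x, ratioKernel z x ∂G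
      = -(1 / 2) * a * z ^ 2 + Complex.I * γ * z + ∫ x, lkKernel z x ∂ν := by
  set d : ℝ → ℝ≥0∞ := fun x => ENNReal.ofReal (sincWeight x)⁻¹ with hd
  have hdm : Measurable d := ENNReal.measurable_ofReal.comp continuous_sincWeight.measurable.inv
  set ν : Measure ℝ := (G.restrict {0}ᶜ).withDensity d with hνdef
  have hν : IsLevyType ν := by
    constructor
    · exact withDensity_absolutelyContinuous _ _ (by
        rw [Measure.restrict_apply (measurableSet_singleton 0)]; simp)
    · rw [lintegral_withDensity_eq_lintegral_mul _ hdm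
        (measurable_min_one_sq.ennreal_ofReal)]
      refine lt_of_le_of_lt (b := ∫⁻ _ in {0}ᶜ, 10 ∂G) (lintegral_mono fun x => ?_) ?_
      · simp only [Pi.mul_apply, hd]
        rw [← ENNReal.ofReal_mul (inv_nonneg.2 (sincWeight_nonneg x)),
          show (10 : ℝ≥0∞) = ENNReal.ofReal 10 by simp]
        refine ENNReal.ofReal_le_ofReal ?_
        rcases eq_or_ne x 0 with rfl | hx
        · simp [sincWeight_zero]
        · have := min_le_sincWeight x
          rw [inv_mul_le_iff₀ (sincWeight_pos hx)]
          linarith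
      · rw [lintegral_const]
        exact ENNReal.mul_lt_top (by simp) (measure_lt_top _ _)
  have hdrift : Integrable (fun x => (Icc (-1 : ℝ) 1).indicator id x - Real.sin x) ν := by
    refine hν.integrable.mono' ?_ (Eventually.of_forall fun x => abs_indicator_sub_sin_le x)
    exact ((measurable_id.indicator measurableSet_Icc).sub Real.measurable_sin).aestronglyMeasurable
  have hK : ∀ z, Integrable (ratioKernel z) G := fun z =>
    (integrable_const (10 * (2 + 3 * z ^ 2 + |z|))).mono'
      (continuous_ratioKernel z).aestronglyMeasurable
      (Eventually.of_forall fun x => norm_ratioKernel_le z x)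
  refine ⟨6 * G.real {0}, ∫ x, ((Icc (-1 : ℝ) 1).indicator id x - Real.sin x) ∂ν, ν, hν,
    fun z => ?_⟩
  have h1 : ∫ x, ratioKernel z x ∂G
      = -3 * (z : ℂ) ^ 2 * G.real {0} + ∫ x in {0}ᶜ, ratioKernel z x ∂G := by
    rw [← integral_add_compl (measurableSet_singleton (0 : ℝ)) (hK z), integral_singleton,
      Complex.real_smul]
    simp only [ratioKernel, if_true]
    ring
  have h2 : ∫ x in {0}ᶜ, ratioKernel z x ∂G = ∫ x, sinKernel z x ∂ν := by
    rw [hνdef, integral_withDensity_eq_integral_toReal_smul hdm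
      (Eventually.of_forall fun x => ENNReal.ofReal_lt_top)]
    refine setIntegral_congr_fun (measurableSet_singleton (0 : ℝ)).compl fun x hx => ?_
    have hx : x ≠ 0 := hx
    simp only [hd, ENNReal.toReal_ofReal (inv_nonneg.2 (sincWeight_nonneg x)), ratioKernel, if_neg hx,
      Complex.real_smul]
    push_cast
    ring
  have h3 : ∫ x, sinKernel z x ∂ν = ∫ x, lkKernel z x ∂ν
      + Complex.I * z * ((∫ x, ((Icc (-1 : ℝ) 1).indicator id x - Real.sin x) ∂ν : ℝ) : ℂ) := by
    rw [← integral_complex_ofReal, ← integral_const_mul,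
      ← integral_add (hν.integrable_lkKernel z) (by exact hdrift.ofReal.const_mul _)]
    refine integral_congr_ae (Eventually.of_forall fun x => ?_)
    have := sinKernel_sub_lkKernel z x
    simp only
    rw [← sub_eq_iff_eq_add', this]
  rw [h1, h2, h3]
  push_cast
  ring

/-- **Lévy–Khintchine formula** for the characteristic exponent of a convolution semigroup: the
measures `n (1 - sin x / x) κ_{1/n}(dx)` have convergent characteristic functions, hence a weak
limit point `G`, and `n (charFun κ_{1/n} - 1)` is an integral against them up to a drift. -/
theorem IsConvolutionSemigroup.exists_levyKhintchine {κ : ℝ≥0 → Measure ℝ}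
    (hκ : IsConvolutionSemigroup κ) {ψ : ℝ → ℂ} (hψc : Continuous ψ)
    (hψ : ∀ (t : ℝ≥0) z, charFun (κ t) z = Complex.exp (t * ψ z)) :
    ∃ (a γ : ℝ) (ν : Measure ℝ), IsLevyType ν ∧ ∀ z : ℝ,
      ψ z = -(1 / 2) * a * z ^ 2 + Complex.I * γ * z + ∫ x, lkKernel z x ∂ν := by
  have hprob := hκ.isProbabilityMeasure
  set t : ℕ → ℝ≥0 := fun n => ((n : ℝ≥0) + 1)⁻¹ with ht
  set q : ℕ → ℝ → ℂ := fun n z => ((n : ℂ) + 1) * (charFun (κ (t n)) z - 1) with hq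
  have hqexp : ∀ n z, q n z = ((n : ℂ) + 1) * (Complex.exp (((n : ℂ) + 1)⁻¹ * ψ z) - 1) :=
    fun n z => by simp only [hq, hψ, ht]; push_cast; rfl
  have hqc : ∀ n, Continuous (q n) := fun n =>
    continuous_const.mul (MeasureTheory.continuous_charFun.sub continuous_const)
  have hqlim : ∀ z, Tendsto (fun n => q n z) atTop (𝓝 (ψ z)) := fun z => by
    simp only [hqexp]; exact tendsto_nat_mul_exp_div_sub_one (ψ z)
  have hqb : ∀ n z, ‖q n z‖ ≤ ‖ψ z‖ * Real.exp ‖ψ z‖ := fun n z => by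
    rw [hqexp]; exact norm_nat_mul_exp_div_sub_one_le _ n
  set D : ℕ → Measure ℝ := fun n => (κ (t n)).withDensity fun x => ENNReal.ofReal (sincWeight x)
    with hD
  have hwm : Measurable fun x => ENNReal.ofReal (sincWeight x) :=
    (ENNReal.continuous_ofReal.comp continuous_sincWeight).measurable
  have hDf : ∀ n, IsFiniteMeasure (D n) := fun n => by
    refine isFiniteMeasure_withDensity (ne_of_lt ?_)
    refine lt_of_le_of_lt (lintegral_mono fun x =>
      ENNReal.ofReal_le_ofReal (sincWeight_le_two x)) ?_
    rw [lintegral_const]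
    exact ENNReal.mul_lt_top ENNReal.ofReal_lt_top (measure_lt_top _ _)
  -- the added point mass keeps the total masses away from `0`
  set m : ℕ → Measure ℝ := fun n => ((n + 1 : ℕ) : ℝ≥0) • D n + Measure.dirac 0 with hm
  have hmf : ∀ n, IsFiniteMeasure (m n) := fun n => by rw [hm]; infer_instance
  have hmint : ∀ n (f : ℝ → ℂ), Continuous f → (∃ C, ∀ x, ‖f x‖ ≤ C) →
      ∫ x, f x ∂(m n) = ((n : ℂ) + 1) * ∫ x, f x ∂(D n) + f 0 := by
    rintro n f hf ⟨C, hC⟩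
    have hi : ∀ μ : Measure ℝ, IsFiniteMeasure μ → Integrable f μ := fun μ _ =>
      (integrable_const C).mono' hf.aestronglyMeasurable (Eventually.of_forall hC)
    rw [hm, integral_add_measure (hi _ inferInstance) (hi _ inferInstance), integral_dirac,
      integral_smul_nnreal_measure]
    rw [NNReal.smul_def, Complex.real_smul]
    push_cast
    rfl
  have hmass : ∀ n, 1 ≤ (m n).real univ := fun n => by
    rw [hm, measureReal_add_apply]
    simp only [measureReal_def, Measure.dirac_apply_of_mem (mem_univ _),
      ENNReal.toReal_one, le_add_iff_nonneg_left]
    positivity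
  have hmchar : ∀ n z, charFun (m n) z
      = q n z - (1 / 2) * (∫ u in (-1 : ℝ)..1, q n (z + u)) + 1 := by
    intro n z
    have h1 : charFun (m n) z = ((n : ℂ) + 1) * charFun (D n) z + 1 := by
      rw [charFun_apply_real, charFun_apply_real, hmint n _ (by fun_prop) ⟨1, fun x => ?_⟩]
      · simp
      · rw [← Complex.ofReal_mul, Complex.norm_exp_ofReal_mul_I]
    rw [h1, hD, charFun_withDensity_sincWeight]
    simp only [hq]
    have hc : Continuous fun u => charFun (κ (t n)) (z + u) :=
      MeasureTheory.continuous_charFun.comp (by fun_prop)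
    rw [intervalIntegral.integral_const_mul, intervalIntegral.integral_sub
      (hc.intervalIntegrable _ _) intervalIntegrable_const, intervalIntegral.integral_const]
    norm_num
    ring
  set Γ : ℝ → ℂ := fun z => ψ z - (1 / 2) * (∫ u in (-1 : ℝ)..1, ψ (z + u)) + 1 with hΓ
  have hΓc : Continuous Γ := by
    have h1 : Continuous fun z => ∫ u in (-1 : ℝ)..1, ψ (z + u) :=
      intervalIntegral.continuous_parametric_intervalIntegral_of_continuous' (by fun_prop) _ _
    fun_prop
  have hmlim : ∀ z, Tendsto (fun n => charFun (m n) z) atTop (𝓝 (Γ z)) := by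
    intro z
    simp only [hmchar]
    have h1 : Tendsto (fun n => ∫ u in (-1 : ℝ)..1, q n (z + u)) atTop
        (𝓝 (∫ u in (-1 : ℝ)..1, ψ (z + u))) := by
      refine intervalIntegral.tendsto_integral_filter_of_dominated_convergence
        (fun u => ‖ψ (z + u)‖ * Real.exp ‖ψ (z + u)‖) (Eventually.of_forall fun n => ?_)
        (Eventually.of_forall fun n => Eventually.of_forall fun u _ => hqb n (z + u)) ?_
        (Eventually.of_forall fun u _ => hqlim (z + u))
      · have := hqc n
        exact Continuous.aestronglyMeasurable (by fun_prop)
      · exact Continuous.intervalIntegrable (by fun_prop) _ _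
    exact ((hqlim z).sub (h1.const_mul _)).add_const _
  obtain ⟨G, hGf, hG⟩ := exists_tendsto_integral_of_tendsto_charFun hmass hΓc.continuousAt hmlim
  -- the drift terms
  set b : ℕ → ℝ := fun n => ((n : ℝ) + 1) * ∫ x, Real.sin x ∂(κ (t n)) with hb
  have hKint : ∀ n z, ∫ x, ratioKernel z x ∂(m n) = q n z - Complex.I * z * b n - 3 * z ^ 2 := by
    intro n z
    rw [hmint n _ (continuous_ratioKernel z) ⟨_, norm_ratioKernel_le z⟩, hD,
      integral_withDensity_eq_integral_toReal_smul hwm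
        (Eventually.of_forall fun x => ENNReal.ofReal_lt_top)]
    have h1 : ∀ x, (ENNReal.ofReal (sincWeight x)).toReal • ratioKernel z x
        = Complex.exp (z * x * Complex.I) - 1 - Complex.I * z * ((Real.sin x : ℝ) : ℂ) := fun x => by
      rw [ENNReal.toReal_ofReal (sincWeight_nonneg x), Complex.real_smul, mul_comm,
        ratioKernel_mul, sinKernel]
      congr 3
      ring
    have hi1 : Integrable (fun x : ℝ => Complex.exp (z * x * Complex.I)) (κ (t n)) :=
      (integrable_const (1 : ℝ)).mono' (by fun_prop) (Eventually.of_forall fun x => by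
        rw [← Complex.ofReal_mul, Complex.norm_exp_ofReal_mul_I])
    have hi2 : Integrable (fun x : ℝ => Real.sin x) (κ (t n)) :=
      (integrable_const (1 : ℝ)).mono' (by fun_prop)
        (Eventually.of_forall fun x => Real.abs_sin_le_one x)
    simp_rw [h1]
    rw [integral_sub (f := fun x : ℝ => Complex.exp (z * x * Complex.I) - 1)
        (by exact hi1.sub (integrable_const _)) (by exact hi2.ofReal.const_mul _),
      integral_sub hi1 (integrable_const _), integral_const_mul, integral_complex_ofReal,
      ← charFun_apply_real]
    simp only [integral_const, probReal_univ, one_smul, hq, hb, ratioKernel, if_true]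
    push_cast
    ring
  have hKlim : ∀ z, Tendsto (fun n => q n z - Complex.I * z * b n - 3 * z ^ 2) (hyperfilter ℕ)
      (𝓝 (∫ x, ratioKernel z x ∂G)) := by
    intro z
    have := hG (BoundedContinuousFunction.ofNormedAddCommGroup (ratioKernel z)
      (continuous_ratioKernel z) _ (norm_ratioKernel_le z))
    refine this.congr fun n => ?_
    rw [← hKint]
    rfl
  have hqlim' : ∀ z, Tendsto (fun n => q n z) (hyperfilter ℕ) (𝓝 (ψ z)) := fun z =>
    (hqlim z).mono_left Nat.hyperfilter_le_atTop
  -- the drifts converge, by the case `z = 1`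
  obtain ⟨b₀, hb₀⟩ : ∃ b₀ : ℝ, Tendsto b (hyperfilter ℕ) (𝓝 b₀) := by
    have h1 := ((hqlim' 1).sub (hKlim 1)).sub_const 3
    refine ⟨_, ((Complex.continuous_im.tendsto _).comp h1).congr fun n => ?_⟩
    simp
  have hfinal : ∀ z, ψ z = ∫ x, ratioKernel z x ∂G + Complex.I * b₀ * z + 3 * z ^ 2 := by
    intro z
    have h1 : Tendsto (fun n => (b n : ℂ)) (hyperfilter ℕ) (𝓝 (b₀ : ℂ)) :=
      (Complex.continuous_ofReal.tendsto _).comp hb₀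
    have h2 := ((hqlim' z).sub (h1.const_mul (Complex.I * z))).sub_const (3 * (z : ℂ) ^ 2)
    have h3 := tendsto_nhds_unique (hKlim z) h2
    rw [h3]
    ring
  obtain ⟨a, γ, ν, hν, hz⟩ := exists_lkKernel_of_ratioKernel (G := G)
  -- the value `-3 z²` of the kernel at the added point mass is subtracted from the Gaussian part
  refine ⟨a - 6, γ + b₀, ν, hν, fun z => ?_⟩
  rw [hfinal, hz]
  push_cast
  ring

/-! ### Convolution semigroups from Lévy processes and from Gaussian laws -/

theorem IsLevyProcess.isConvolutionSemigroup {Ω : Type*} [MeasurableSpace Ω] {P : Measure Ω}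
    [IsProbabilityMeasure P] {L : ℝ≥0 → Ω → ℝ} (hL : IsLevyProcess L P) :
    IsConvolutionSemigroup fun t => P.map (L t) where
  isProbabilityMeasure t := Measure.isProbabilityMeasure_map (hL.measurable t).aemeasurable
  charFun_at_zero z := by
    have h : P.map (L 0) = P.map fun _ => (0 : ℝ) := Measure.map_congr hL.zero
    rw [h, Measure.map_const]
    simp
  charFun_add s t z := by
    have hind : IndepFun (L s) (L (s + t) - L s) P :=
      hL.indep.indepFun_eval_sub zero_le le_self_add hL.zero
    have hinc : P.map (L (s + t) - L s) = P.map (L t) := by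
      refine (hL.stationary s t).trans (Measure.map_congr ?_)
      filter_upwards [hL.zero] with ω hω
      rw [hω, sub_zero]
    have h := hind.charFun_map_add_eq_mul (hL.measurable s).aemeasurable
      ((hL.measurable (s + t)).sub (hL.measurable s)).aemeasurable
    rw [add_sub_cancel, hinc] at h
    exact congrFun h z
  continuous_charFun_time z := by
    refine continuous_iff_seqContinuous.2 fun u t hu => ?_
    have h1 : TendstoInMeasure P (fun n => L (u n)) atTop (L t) :=
      fun ε hε => (hL.stochContinuous t ε hε).comp hu
    have h2 := (h1.tendstoInDistribution fun n => (hL.measurable (u n)).aemeasurable).tendsto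
    exact ProbabilityMeasure.tendsto_iff_tendsto_charFun.1 h2 z

theorem isConvolutionSemigroup_gaussianReal :
    IsConvolutionSemigroup fun t => gaussianReal 0 t where
  isProbabilityMeasure t := inferInstance
  charFun_at_zero z := by simp
  charFun_add s t z := by
    simp only [charFun_gaussianReal]
    rw [← Complex.exp_add]
    congr 1
    push_cast
    ring
  continuous_charFun_time z := by
    simp only [charFun_gaussianReal]
    fun_prop

theorem isSymmetric_gaussianReal_zero (v : ℝ≥0) : IsSymmetric (gaussianReal 0 v) := by
  rw [IsSymmetric, gaussianReal_map_neg, neg_zero]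

/-! ### Mixtures of measures -/

theorem charFun_bind {m : Measure ℝ} [IsFiniteMeasure m] {f : ℝ → Measure ℝ} (hf : Measurable f)
    (hprob : ∀ t, IsProbabilityMeasure (f t)) (z : ℝ) :
    charFun (m.bind f) z = ∫ t, charFun (f t) z ∂m := by
  let k : Kernel ℝ ℝ := ⟨f, hf⟩
  have : IsMarkovKernel k := ⟨hprob⟩
  have hi : Integrable (fun x : ℝ => Complex.exp (z * x * Complex.I)) (m.bind k) :=
    (integrable_const (1 : ℝ)).mono' (by fun_prop) (Eventually.of_forall fun x => by
      rw [← Complex.ofReal_mul, Complex.norm_exp_ofReal_mul_I])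
  rw [charFun_apply_real]
  simp_rw [charFun_apply_real]
  change ∫ x, Complex.exp (z * x * Complex.I) ∂(m.bind k) = _
  rw [Measure.comp_eq_comp_const_apply] at hi ⊢
  rw [Kernel.integral_comp hi, Kernel.const_apply]
  rfl

theorem bind_absolutelyContinuous {m : Measure ℝ} {f : ℝ → Measure ℝ} (hf : Measurable f)
    {ξ : Measure ℝ} (h : ∀ᵐ t ∂m, f t ≪ ξ) : m.bind f ≪ ξ := by
  refine Measure.AbsolutelyContinuous.mk fun s hs hξ => ?_
  have hm : Measurable fun t => f t s := (Measure.measurable_coe hs).comp hf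
  rw [Measure.bind_apply hs hf.aemeasurable, lintegral_eq_zero_iff hm]
  filter_upwards [h] with t ht using ht hξ

theorem bind_apply_univ {m : Measure ℝ} {f : ℝ → Measure ℝ} (hf : Measurable f)
    (hprob : ∀ t, IsProbabilityMeasure (f t)) : m.bind f univ = m univ := by
  rw [Measure.bind_apply MeasurableSet.univ hf.aemeasurable]
  simp

theorem restrict_Ici_of_measure_Iio {ρ : Measure ℝ} {t₁ : ℝ} (hρ : ρ (Iio t₁) = 0) :
    ρ.restrict (Ici t₁) = ρ := by
  refine Measure.restrict_eq_self_of_ae_mem ?_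
  rw [ae_iff]
  simpa [Iio_def] using hρ

variable {κ : ℝ≥0 → Measure ℝ}

theorem IsConvolutionSemigroup.measurable_toNNReal (hκ : IsConvolutionSemigroup κ) (c : ℝ) :
    Measurable fun t : ℝ => κ (t - c).toNNReal :=
  hκ.measurable.comp (measurable_real_toNNReal.comp (measurable_id.sub_const c))

theorem IsConvolutionSemigroup.isMixture (hκ : IsConvolutionSemigroup κ) {ρ : Measure ℝ}
    [IsProbabilityMeasure ρ] {t₁ : ℝ} (hρ : ρ (Iio t₁) = 0) :
    IsMixture (mixture κ ρ t₁) κ ρ t₁ := by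
  have hm : Measurable fun t : ℝ => κ t.toNNReal := hκ.measurable.comp measurable_real_toNNReal
  refine ⟨⟨?_⟩, fun B hB => ⟨(Measure.measurable_coe hB).comp hm,
    Measure.bind_apply hB hm.aemeasurable⟩⟩
  rw [mixture, bind_apply_univ hm fun t => hκ.isProbabilityMeasure _,
    restrict_Ici_of_measure_Iio hρ, measure_univ]

theorem IsConvolutionSemigroup.charFun_mixture (hκ : IsConvolutionSemigroup κ) {ρ : Measure ℝ}
    [IsProbabilityMeasure ρ] {t₁ : ℝ} (hρ : ρ (Iio t₁) = 0) (z : ℝ) :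
    charFun (mixture κ ρ t₁) z = ∫ t, charFun (κ t.toNNReal) z ∂ρ := by
  have hm : Measurable fun t : ℝ => κ t.toNNReal := hκ.measurable.comp measurable_real_toNNReal
  rw [mixture, restrict_Ici_of_measure_Iio hρ, charFun_bind hm fun t => hκ.isProbabilityMeasure _]

/-- The law of the increment of the semigroup after time `t₁`, run up to a random time of
distribution `ρ`, on the event that this time is larger than `t₁`. -/
def residual (κ : ℝ≥0 → Measure ℝ) (ρ : Measure ℝ) (t₁ : ℝ) : Measure ℝ :=
  (ρ.restrict (Ioi t₁)).bind fun t => κ (t - t₁).toNNReal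

/-- Splitting off the convolution factor `κ t₁` turns the mixture into the atom `ρ {t₁} δ₀` plus
the residual measure. -/
theorem IsConvolutionSemigroup.charFun_mixture_eq_mul (hκ : IsConvolutionSemigroup κ)
    {ρ : Measure ℝ} [IsProbabilityMeasure ρ] {t₁ : ℝ} (ht₁ : 0 < t₁) (hρ : ρ (Iio t₁) = 0) (z : ℝ) :
    charFun (mixture κ ρ t₁) z = charFun (κ t₁.toNNReal) z
      * (ρ.real {t₁} + charFun (residual κ ρ t₁) z) := by
  have hprob := hκ.isProbabilityMeasure
  have hm : Measurable fun t : ℝ => charFun (κ t.toNNReal) z :=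
    ((hκ.continuous_charFun_time z).comp continuous_real_toNNReal).measurable
  have hi : Integrable (fun t : ℝ => charFun (κ t.toNNReal) z) ρ :=
    (integrable_const (1 : ℝ)).mono' hm.aestronglyMeasurable
      (Eventually.of_forall fun t => norm_charFun_le_one z)
  rw [hκ.charFun_mixture hρ, ← setIntegral_univ, ← Iio_union_Ici (a := t₁),
    setIntegral_union (by exact (Iio_disjoint_Ici le_rfl)) measurableSet_Ici
      hi.integrableOn hi.integrableOn, setIntegral_measure_zero _ hρ, zero_add,
    ← Ioi_insert, ← singleton_union, setIntegral_union (by simp) measurableSet_Ioi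
      hi.integrableOn hi.integrableOn, integral_singleton, residual,
    charFun_bind (hκ.measurable_toNNReal t₁) fun t => hκ.isProbabilityMeasure _, mul_add,
    Complex.real_smul, mul_comm, ← integral_const_mul]
  congr 1
  refine setIntegral_congr_fun measurableSet_Ioi fun t ht => ?_
  have ht : t₁ < t := ht
  rw [← hκ.charFun_add, ← Real.toNNReal_add ht₁.le (by linarith), add_sub_cancel]

/-- The atom of `ρ` at `t₁` gives the second factor of the characteristic function of the mixture
the form `p + charFun η` with `p ≠ 0` and `η` absolutely continuous, so that the Wiener–Lévy theorem
applies to it. -/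
theorem IsConvolutionSemigroup.isQuasiInfinitelyDivisible_mixture_iff
    (hκ : IsConvolutionSemigroup κ) (hac : ∀ t, 0 < t → κ t ≪ volume) {ρ : Measure ℝ}
    [IsProbabilityMeasure ρ] {t₁ : ℝ} (ht₁ : 0 < t₁) (hρ : ρ (Iio t₁) = 0) (hρ₁ : 0 < ρ {t₁}) :
    IsQuasiInfinitelyDivisible (mixture κ ρ t₁) ↔ ∀ z, charFun (mixture κ ρ t₁) z ≠ 0 := by
  refine ⟨fun h => h.charFun_ne_zero, fun hne => ?_⟩
  have hprob := hκ.isProbabilityMeasure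
  have hμ := (hκ.isMixture hρ).1
  have huniv : residual κ ρ t₁ univ = ρ (Ioi t₁) := by
    rw [residual, bind_apply_univ (hκ.measurable_toNNReal t₁) fun t => hκ.isProbabilityMeasure _,
      Measure.restrict_apply_univ]
  have hfin : IsFiniteMeasure (residual κ ρ t₁) := ⟨by rw [huniv]; exact measure_lt_top _ _⟩
  have hηac : residual κ ρ t₁ ≪ volume := by
    refine bind_absolutelyContinuous (hκ.measurable_toNNReal t₁) ?_
    filter_upwards [ae_restrict_mem measurableSet_Ioi] with t ht
    exact hac _ (Real.toNNReal_pos.2 (sub_pos.2 ht))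
  have hp : ρ.real {t₁} ≠ 0 := (ENNReal.toReal_pos hρ₁.ne' (measure_ne_top _ _)).ne'
  have hmass : ρ.real {t₁} + (residual κ ρ t₁).real univ = 1 := by
    have h1 : (residual κ ρ t₁).real univ = ρ.real (Ioi t₁) := by
      rw [measureReal_def, huniv, measureReal_def]
    rw [h1, ← measureReal_union (by simp) measurableSet_Ioi, singleton_union, Ioi_insert,
      ← compl_Iio, probReal_compl_eq_one_sub measurableSet_Iio, measureReal_def, hρ]
    simp
  have hsplit := hκ.charFun_mixture_eq_mul ht₁ hρ
  obtain ⟨γ, α, β, hα, hβ, hηexp⟩ := exists_add_charFun_eq_exp hηac hp hmass fun z h0 =>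
    hne z (by rw [hsplit, h0, mul_zero])
  obtain ⟨ψ, hψc, -, hψ⟩ := hκ.exists_exponent
  obtain ⟨a, γ', ν, hν, hψν⟩ := hκ.exists_levyKhintchine hψc hψ
  have hν' : IsLevyType (t₁.toNNReal • ν) := hν.smul _
  refine .of_charFun_eq (hν'.add hα) hβ (t₁ * a) (t₁ * γ' + γ) fun z => ?_
  rw [hsplit, hηexp, hψ, hψν, ← Complex.exp_add, integral_add_measure (hν'.integrable_lkKernel z)
    (hα.integrable_lkKernel z), integral_smul_nnreal_measure, NNReal.smul_def, Complex.real_smul,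
    Real.coe_toNNReal _ ht₁.le]
  congr 1
  push_cast
  ring

/-! ### Symmetric semigroups -/

theorem IsSymmetric.im_charFun {μ : Measure ℝ} (h : IsSymmetric μ) (z : ℝ) :
    (charFun μ z).im = 0 := by
  have h1 : charFun μ (-z) = charFun μ z := by
    conv_rhs => rw [← h]
    have := charFun_map_mul (μ := μ) (-1) z
    simpa using this.symm
  rw [charFun_neg] at h1
  exact Complex.conj_eq_iff_im.1 h1

/-- A continuous function with values in `ℤ π` that vanishes at `0` is zero, so a real exponential
of the exponent forces a real exponent. -/
theorem im_eq_zero_of_im_exp_eq_zero {ψ : ℝ → ℂ} (hψc : Continuous ψ) (h0 : ψ 0 = 0)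
    (h : ∀ z, (Complex.exp (ψ z)).im = 0) (z : ℝ) : (ψ z).im = 0 := by
  have hsin : ∀ z, Real.sin (ψ z).im = 0 := fun z => by
    have := h z
    rw [Complex.exp_im] at this
    exact (mul_eq_zero.1 this).resolve_left (Real.exp_ne_zero _)
  choose k hk using fun z => Real.sin_eq_zero_iff.1 (hsin z)
  have hkc : Continuous k := by
    have h1 : Continuous fun z => (k z : ℝ) := by
      have : (fun z => (k z : ℝ)) = fun z => (ψ z).im / Real.pi := by
        ext z
        rw [← hk z, mul_div_cancel_right₀ _ Real.pi_ne_zero]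
      rw [this]
      fun_prop
    exact Int.isClosedEmbedding_coe_real.isInducing.continuous_iff.2 h1
  have hk0 : k z = k 0 := PreconnectedSpace.constant inferInstance hkc
  have h00 := hk 0
  rw [h0, Complex.zero_im] at h00
  rw [← hk z, hk0, h00]

theorem IsConvolutionSemigroup.charFun_mixture_ne_zero (hκ : IsConvolutionSemigroup κ)
    (hs : IsSymmetric (κ 1)) {ρ : Measure ℝ} [IsProbabilityMeasure ρ] {t₁ : ℝ}
    (hρ : ρ (Iio t₁) = 0) (z : ℝ) : charFun (mixture κ ρ t₁) z ≠ 0 := by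
  obtain ⟨ψ, hψc, hψ0, hψ⟩ := hκ.exists_exponent
  have him : (ψ z).im = 0 := by
    refine im_eq_zero_of_im_exp_eq_zero hψc hψ0 (fun z => ?_) z
    have := hs.im_charFun z
    rwa [hψ, NNReal.coe_one, Complex.ofReal_one, one_mul] at this
  have hprob := hκ.isProbabilityMeasure
  have hexp : ∀ t : ℝ, charFun (κ t.toNNReal) z
      = ((Real.exp (t.toNNReal * (ψ z).re) : ℝ) : ℂ) := fun t => by
    rw [hψ]
    push_cast
    congr 2
    exact Complex.ext rfl (by simpa using him)
  rw [hκ.charFun_mixture hρ]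
  simp_rw [hexp]
  rw [integral_complex_ofReal, Complex.ofReal_ne_zero]
  refine (integral_pos_iff_support_of_nonneg (fun t => (Real.exp_pos _).le) ?_).2 ?_ |>.ne'
  · have hm : Measurable fun t : ℝ => Real.exp (t.toNNReal * (ψ z).re) := by fun_prop
    refine (integrable_const (1 : ℝ)).mono' hm.aestronglyMeasurable
      (Eventually.of_forall fun t => ?_)
    rw [← Complex.norm_real, ← hexp]
    exact norm_charFun_le_one z
  · have : (Function.support fun t : ℝ => Real.exp (t.toNNReal * (ψ z).re)) = univ :=
      Function.support_eq_univ fun t => (Real.exp_pos _).ne'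
    rw [this, measure_univ]
    exact one_pos

theorem isQuasiInfinitelyDivisible_mixture_gaussianReal {ρ : Measure ℝ} [IsProbabilityMeasure ρ]
    {t₁ : ℝ} (ht₁ : 0 < t₁) (hρ : ρ (Iio t₁) = 0) (hρ₁ : 0 < ρ {t₁}) :
    IsQuasiInfinitelyDivisible (mixture (fun t => gaussianReal 0 t) ρ t₁) :=
  (isConvolutionSemigroup_gaussianReal.isQuasiInfinitelyDivisible_mixture_iff
    (fun _ ht => gaussianReal_absolutelyContinuous 0 ht.ne') ht₁ hρ hρ₁).2
    (isConvolutionSemigroup_gaussianReal.charFun_mixture_ne_zero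
      (isSymmetric_gaussianReal_zero 1) hρ)

/-! ### Finite mixtures -/

/-- A finite mixture is the mixture over the discrete distribution `∑ p i • δ (t i)`, which has
an atom at the smallest of the times. -/
theorem IsConvolutionSemigroup.exists_mixture_eq_sum (hκ : IsConvolutionSemigroup κ) {n : ℕ}
    {t p : Fin n → ℝ≥0} (ht : ∀ i, 0 < t i) (hp : ∀ i, 0 < p i) (h1 : ∑ i, p i = 1) :
    ∃ (ρ : Measure ℝ) (t₁ : ℝ), IsProbabilityMeasure ρ ∧ 0 < t₁ ∧ ρ (Iio t₁) = 0 ∧ 0 < ρ {t₁} ∧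
      ∑ i, p i • κ (t i) = mixture κ ρ t₁ := by
  have hne : Nonempty (Fin n) := by
    by_contra h
    rw [not_nonempty_iff] at h
    simp at h1
  obtain ⟨i₀, hi₀⟩ := Finite.exists_min t
  set ρ : Measure ℝ := ∑ i, p i • Measure.dirac (t i : ℝ) with hρ
  have happ : ∀ s, ρ s = ∑ i, (p i : ℝ≥0∞) * Measure.dirac (t i : ℝ) s := fun s => by
    rw [hρ, Measure.finsetSum_apply]
    rfl
  have hIio : ρ (Iio (t i₀ : ℝ)) = 0 := by
    rw [happ]
    refine Finset.sum_eq_zero fun i _ => ?_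
    rw [Measure.dirac_apply' _ measurableSet_Iio, indicator_of_notMem, mul_zero]
    simpa using hi₀ i
  have hprob : IsProbabilityMeasure ρ := ⟨by
    rw [happ]
    simp only [measure_univ, mul_one]
    exact_mod_cast h1⟩
  refine ⟨ρ, t i₀, hprob, by exact_mod_cast ht i₀, hIio, ?_, ?_⟩
  · rw [happ]
    refine lt_of_lt_of_le (ENNReal.coe_pos.2 (hp i₀)) ?_
    refine le_trans ?_ (Finset.single_le_sum (fun i _ => zero_le) (Finset.mem_univ i₀))
    rw [Measure.dirac_apply_of_mem (mem_singleton _), mul_one]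
  · have hm : Measurable fun t : ℝ => κ t.toNNReal := hκ.measurable.comp measurable_real_toNNReal
    ext B hB
    rw [mixture, restrict_Ici_of_measure_Iio hIio, Measure.bind_apply hB hm.aemeasurable, hρ,
      lintegral_finsetSum_measure, Measure.finsetSum_apply]
    refine Finset.sum_congr rfl fun i _ => ?_
    have hmB : Measurable fun t : ℝ => κ t.toNNReal B := (Measure.measurable_coe hB).comp hm
    rw [lintegral_smul_measure, lintegral_dirac' _ hmB, Real.toNNReal_coe]
    rfl

end QuasiID

end

theorem mainTheorem4 :
    -- mixtures of the marginals of a Lévy process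
    (∀ {Ω : Type*} [MeasurableSpace Ω] (P : Measure Ω) [IsProbabilityMeasure P]
      (L : ℝ≥0 → Ω → ℝ), QuasiID.IsLevyProcess L P → (∀ t : ℝ≥0, 0 < t → P.map (L t) ≪ volume) →
      -- general mixing distributions
      (∀ (ρ : Measure ℝ) [IsProbabilityMeasure ρ] (t₁ : ℝ),
        0 < t₁ → ρ (Iio t₁) = 0 → 0 < ρ {t₁} →
        ∀ μ : Measure ℝ, μ = QuasiID.mixture (fun t => P.map (L t)) ρ t₁ →
          QuasiID.IsMixture μ (fun t => P.map (L t)) ρ t₁ ∧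
          (QuasiID.IsQuasiInfinitelyDivisible μ ↔ ∀ z : ℝ, charFun μ z ≠ 0) ∧
          (QuasiID.IsSymmetric (P.map (L 1)) →
            (∀ z : ℝ, charFun μ z ≠ 0) ∧ QuasiID.IsQuasiInfinitelyDivisible μ)) ∧
      -- finite mixtures
      (∀ (n : ℕ) (t p : Fin n → ℝ≥0), StrictMono t → (∀ i, 0 < t i) → (∀ i, 0 < p i) →
        ∑ i, p i = 1 →
        ∀ μ : Measure ℝ, μ = ∑ i, p i • P.map (L (t i)) →
          (QuasiID.IsQuasiInfinitelyDivisible μ ↔ ∀ z : ℝ, charFun μ z ≠ 0) ∧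
          (QuasiID.IsSymmetric (P.map (L 1)) →
            (∀ z : ℝ, charFun μ z ≠ 0) ∧ QuasiID.IsQuasiInfinitelyDivisible μ))) ∧
    -- variance mixtures of centred normal distributions
    (∀ (ρ : Measure ℝ) [IsProbabilityMeasure ρ] (t₁ : ℝ),
      0 < t₁ → ρ (Iio t₁) = 0 → 0 < ρ {t₁} →
      ∀ μ : Measure ℝ, μ = QuasiID.mixture (fun t => gaussianReal 0 t) ρ t₁ →
        QuasiID.IsMixture μ (fun t => gaussianReal 0 t) ρ t₁ ∧
        QuasiID.IsQuasiInfinitelyDivisible μ) ∧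
    (∀ (n : ℕ) (a p : Fin n → ℝ≥0), (∀ i, 0 < a i) → (∀ i, 0 < p i) → ∑ i, p i = 1 →
      QuasiID.IsQuasiInfinitelyDivisible (∑ i, p i • gaussianReal 0 (a i))) := by
  refine ⟨fun P _ L hL hac => ⟨fun ρ _ t₁ ht₁ hρ hρ₁ μ hμ => ?_, fun n t p _ ht hp h1 μ hμ => ?_⟩,
    fun ρ _ t₁ ht₁ hρ hρ₁ μ hμ => ?_, fun n a p ha hp h1 => ?_⟩
  · subst hμ
    have hκ := hL.isConvolutionSemigroup
    have hiff := hκ.isQuasiInfinitelyDivisible_mixture_iff hac ht₁ hρ hρ₁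
    exact ⟨hκ.isMixture hρ, hiff, fun hs =>
      ⟨hκ.charFun_mixture_ne_zero hs hρ, hiff.2 (hκ.charFun_mixture_ne_zero hs hρ)⟩⟩
  · have hκ := hL.isConvolutionSemigroup
    obtain ⟨ρ, t₁, hprob, ht₁, hρ, hρ₁, h⟩ := hκ.exists_mixture_eq_sum ht hp h1
    rw [hμ, h]
    have hiff := hκ.isQuasiInfinitelyDivisible_mixture_iff hac ht₁ hρ hρ₁
    exact ⟨hiff, fun hs =>
      ⟨hκ.charFun_mixture_ne_zero hs hρ, hiff.2 (hκ.charFun_mixture_ne_zero hs hρ)⟩⟩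
  · subst hμ
    exact ⟨QuasiID.isConvolutionSemigroup_gaussianReal.isMixture hρ,
      QuasiID.isQuasiInfinitelyDivisible_mixture_gaussianReal ht₁ hρ hρ₁⟩
  · obtain ⟨ρ, t₁, hprob, ht₁, hρ, hρ₁, h⟩ :=
      QuasiID.isConvolutionSemigroup_gaussianReal.exists_mixture_eq_sum ha hp h1
    rw [h]
    exact QuasiID.isQuasiInfinitelyDivisible_mixture_gaussianReal ht₁ hρ hρ₁
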